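/- Let $G$ be a finite group, and let $n_\ell$ run over the dimensions of the irreducible complex representations of $G$ (one for each isomorphism class). A *map* $M=(V,E,F)$ is a finite graph $(V,E)$ (loops, multiple edges, isolated vertices and several components allowed), each component of which is $2$-cell embedded in its own closed connected oriented surface; it is given by its rotation system, i.e. by the anticlockwise cyclic order of the half-edges around each vertex, and its set $F$ of faces consists of the cycles of the following face-tracing procedure on half-edges, together with one face for each isolated vertex: from a half-edge, move to the other end of its edge and select the previous half-edge in the anticlockwise order there. Write $e,v,f,k$ for the numbers of edges, vertices, faces and connected components of a map; let $n=e-v+k$ be the nullity and $n^*=e-f+k$ the dual nullity. For a connected component $M_j$ of a map let $\chi(M_j)=v(M_j)-e(M_j)+f(M_j)$ be its Euler characteristic. For $A\subseteq E$, $M\setminus A$ is the map obtained by deleting the edges in $A$ (same vertices, induced rotations), and $M/A$ is the map obtained by contracting them, that is, $(M/A)^*=M^*\setminus A$, where $^*$ denotes the surface dual; $A^c=E\setminus A$. Direct the edges of $M$ arbitrarily. A *local $G$-flow* is an assignment of elements of $G$ to the edges such that around each vertex the product of the values in anticlockwise order, with values on incoming edges inverted, is the identity. A *local $G$-tension* is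 an assignment of elements of $G$ to the edges such that around each face the product of the values in anticlockwise order, with values on backward edges inverted, is the identity. Either is *nowhere-identity* if no edge has the identity as its value. **Theorem.** Let $M=(V,E,F)$ be a map. (i) The number of nowhere-identity local $G$-flows of $M$ is $$q_G(M)=\sum_{A\subseteq E}(-1)^{|A^c|}\,|G|^{n(M\setminus A^c)}\prod_{M_j}\Bigl(\frac1{|G|}\sum_\ell n_\ell^{\chi(M_j)}\Bigr),$$ where the product is over the connected components $M_j$ of $M\setminus A^c$. (ii) The number of nowhere-identity local $G$-tensions of $M$ is $$p_G(M)=\sum_{A\subseteq E}(-1)^{|A|}\,|G|^{n^*(M/A)}\prod_{M_i}\Bigl(\frac1{|G|}\sum_\ell n_\ell^{\chi(M_i)}\Bigr),$$ where the product is over the connected components $M_i$ of $M/A$. -/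

import Mathlib

/-! ### Maps (graphs embedded in oriented surfaces), given by rotation systems -/

namespace SurfaceMap

section FirstReturn

variable {D : Type*} [Finite D]

theorem exists_return (σ : Equiv.Perm D) (p : D → Prop) (d : {d // p d}) :
    ∃ k : ℕ, 0 < k ∧ p ((σ ^ k) d.1) :=
  ⟨orderOf σ, orderOf_pos σ, by rw [pow_orderOf_eq_one]; exact d.2⟩

open Classical in
/-- The number of steps after which the `σ`-orbit of `d` first comes back to the set `p`. -/
noncomputable def returnTime (σ : Equiv.Perm D) (p : D → Prop) (d : {d // p d}) : ℕ :=
  Nat.find (exists_return σ p d)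

theorem returnTime_pos (σ : Equiv.Perm D) (p : D → Prop) (d : {d // p d}) :
    0 < returnTime σ p d := by
  classical
  exact (Nat.find_spec (exists_return σ p d)).1

theorem returnTime_spec (σ : Equiv.Perm D) (p : D → Prop) (d : {d // p d}) :
    p ((σ ^ returnTime σ p d) d.1) := by
  classical
  exact (Nat.find_spec (exists_return σ p d)).2

theorem returnTime_le (σ : Equiv.Perm D) (p : D → Prop) (d : {d // p d}) {k : ℕ} (hk : 0 < k)
    (h : p ((σ ^ k) d.1)) : returnTime σ p d ≤ k := by
  classical
  exact Nat.find_min' (exists_return σ p d) ⟨hk, h⟩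

/-- The first element of `p` met after `d` when `σ` is applied repeatedly. -/
noncomputable def nextReturn (σ : Equiv.Perm D) (p : D → Prop) (d : {d // p d}) : {d // p d} :=
  ⟨(σ ^ returnTime σ p d) d.1, returnTime_spec σ p d⟩

theorem nextReturn_injective (σ : Equiv.Perm D) (p : D → Prop) :
    Function.Injective (nextReturn σ p) := by
  have key : ∀ d d' : {d // p d}, returnTime σ p d ≤ returnTime σ p d' →
      nextReturn σ p d = nextReturn σ p d' → d = d' := by
    intro d d' hle h
    have h1 : (σ ^ returnTime σ p d) d.1 = (σ ^ returnTime σ p d') d'.1 :=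
      congrArg Subtype.val h
    obtain ⟨m, hm⟩ := Nat.exists_eq_add_of_le hle
    rw [hm, pow_add, Equiv.Perm.mul_apply] at h1
    have h2 : d.1 = (σ ^ m) d'.1 := (σ ^ returnTime σ p d).injective h1
    rcases Nat.eq_zero_or_pos m with rfl | hpos
    · exact Subtype.ext (by simpa using h2)
    · have h3 := returnTime_le σ p d' hpos (h2 ▸ d.2)
      have h4 := returnTime_pos σ p d
      omega
  intro d d' h
  rcases le_total (returnTime σ p d) (returnTime σ p d') with hle | hle
  · exact key d d' hle h
  · exact (key d' d hle h.symm).symm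

/-- The permutation induced by `σ` on the subset `p`: delete from every cycle of `σ` the elements
outside `p`, keeping the cyclic order of the remaining ones. -/
noncomputable def firstReturn (σ : Equiv.Perm D) (p : D → Prop) : Equiv.Perm {d // p d} :=
  Equiv.ofBijective (nextReturn σ p) (Finite.injective_iff_bijective.1 (nextReturn_injective σ p))

theorem firstReturn_apply (σ : Equiv.Perm D) (p : D → Prop) (d : {d // p d}) :
    (firstReturn σ p d).1 = (σ ^ returnTime σ p d) d.1 := rfl

theorem firstReturn_sameCycle_iff (σ : Equiv.Perm D) (p : D → Prop) (d d' : {d // p d}) :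
    (firstReturn σ p).SameCycle d d' ↔ σ.SameCycle d.1 d'.1 := by
  constructor
  · intro h
    obtain ⟨n, hn⟩ := h.exists_nat_pow_eq
    clear h
    induction n generalizing d with
    | zero =>
      have h0 : d = d' := by simpa using hn
      exact h0 ▸ Equiv.Perm.SameCycle.refl _ _
    | succ n ih =>
      rw [pow_succ, Equiv.Perm.mul_apply] at hn
      have := ih _ hn
      rw [firstReturn_apply, Equiv.Perm.sameCycle_pow_left] at this
      exact this
  · intro h
    obtain ⟨n, hn⟩ := h.exists_nat_pow_eq
    clear h
    induction n using Nat.strong_induction_on generalizing d with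
    | _ n ih =>
      rcases Nat.eq_zero_or_pos n with rfl | hpos
      · have h0 : d = d' := Subtype.ext (by simpa using hn)
        exact h0 ▸ Equiv.Perm.SameCycle.refl _ _
      · have hle := returnTime_le σ p d hpos (hn ▸ d'.2)
        have ht := returnTime_pos σ p d
        have h1 := ih (n - returnTime σ p d) (by omega) (firstReturn σ p d) (by
          rw [firstReturn_apply, ← Equiv.Perm.mul_apply, ← pow_add, Nat.sub_add_cancel hle]
          exact hn)
        exact Equiv.Perm.sameCycle_apply_left.1 h1

end FirstReturn

/-- A map with vertex set `V` and edge set `E`, that is, a graph (loops, multiple edges, isolated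
vertices and several components allowed) with a rotation system. Every edge `e` carries an
arbitrary direction; its two half-edges are `(e, true)` (at its tail, where `e` is outgoing) and
`(e, false)` (at its head, where `e` is incoming). The permutation `rot` sends each half-edge to the
next one in the anticlockwise order around its vertex, so its cycles are exactly the nonempty sets
of half-edges at the vertices. Vertices outside the range of `vert` are isolated: each of
them is a component by itself, embedded in a sphere. -/
structure RotMap (V E : Type*) where
  vert : E × Bool → V
  rot : Equiv.Perm (E × Bool)
  vert_eq_iff : ∀ d d' : E × Bool, vert d = vert d' ↔ rot.SameCycle d d'

namespace RotMap

variable {V E : Type*}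

/-- The other half of the same edge. -/
def otherHalf (E : Type*) : Equiv.Perm (E × Bool) :=
  Equiv.prodCongr (Equiv.refl E) Equiv.boolNot

/-- Face tracing: a half-edge `d` stands for its edge traversed away from the vertex of `d`; move
to the other end and select the previous half-edge in the anticlockwise order there. The cycles are
the boundary walks of the faces (with the face on the left, i.e. anticlockwise). -/
def facePerm (M : RotMap V E) : Equiv.Perm (E × Bool) := M.rot⁻¹ * otherHalf E

/-- The faces: the cycles of face tracing, and one face for every isolated vertex. -/
abbrev Face (M : RotMap V E) : Type _ :=
  Quotient (Equiv.Perm.SameCycle.setoid M.facePerm) ⊕ {v : V // v ∉ Set.range M.vert}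

/-- The surface dual. Its vertices are the faces of `M`, its edges those of `M`, and the half-edge
`d` lies at the face to the left of `d`; the anticlockwise rotation around a face is the
order of its boundary walk. -/
def dual (M : RotMap V E) : RotMap M.Face E where
  vert d := Sum.inl (Quotient.mk _ d)
  rot := M.facePerm
  vert_eq_iff d d' := by
    rw [Sum.inl_injective.eq_iff]
    exact Quotient.eq

/-- The half-edges of the submap with the edges in `A` deleted. -/
def keptHalfEdges (A : Finset E) : {d : E × Bool // d.1 ∉ A} ≃ {e : E // e ∉ A} × Bool :=
  Equiv.prodSubtypeFstEquivSubtypeProd (p := fun e : E => e ∉ A)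

/-- Deletion of the edges in `A`: same vertices, and around each vertex the rotation goes to the
next half-edge that is not deleted. -/
noncomputable def delete [Finite E] (M : RotMap V E) (A : Finset E) :
    RotMap V {e : E // e ∉ A} where
  vert d := M.vert (d.1.1, d.2)
  rot := (keptHalfEdges A).permCongr (firstReturn M.rot fun d => d.1 ∉ A)
  vert_eq_iff d d' := by
    rw [M.vert_eq_iff]
    have h := firstReturn_sameCycle_iff M.rot (fun d => d.1 ∉ A)
      ((keptHalfEdges A).symm d) ((keptHalfEdges A).symm d')
    have h2 : ∀ (σ : Equiv.Perm {d : E × Bool // d.1 ∉ A}) x y,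
        ((keptHalfEdges A).permCongr σ).SameCycle x y ↔
          σ.SameCycle ((keptHalfEdges A).symm x) ((keptHalfEdges A).symm y) := by
      intro σ x y
      have hp : ∀ n : ℤ, ((keptHalfEdges A).permCongr σ) ^ n = (keptHalfEdges A).permCongr (σ ^ n) :=
        fun n => (map_zpow (keptHalfEdges A).permCongrHom σ n).symm
      simp only [Equiv.Perm.SameCycle, hp, Equiv.permCongr_apply, Equiv.eq_symm_apply]
    rw [h2, h]
    rfl

/-- Contraction of the edges in `A`, defined by duality: `(M / A)* = M* \ A`. -/
noncomputable def contract [Finite E] (M : RotMap V E) (A : Finset E) :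
    RotMap (M.dual.delete A).Face {e : E // e ∉ A} :=
  (M.dual.delete A).dual

/-- Adjacency in the underlying graph. -/
def underlying (M : RotMap V E) : SimpleGraph V :=
  SimpleGraph.fromRel fun u v => ∃ e : E, M.vert (e, true) = u ∧ M.vert (e, false) = v

/-- The connected components. -/
abbrev Component (M : RotMap V E) : Type _ := M.underlying.ConnectedComponent

/-- The component containing a vertex. -/
def vertComp (M : RotMap V E) (v : V) : M.Component := M.underlying.connectedComponentMk v

theorem vertComp_otherHalf (M : RotMap V E) (d : E × Bool) :
    M.vertComp (M.vert (otherHalf E d)) = M.vertComp (M.vert d) := by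
  have key : ∀ e, M.vertComp (M.vert (e, true)) = M.vertComp (M.vert (e, false)) := by
    intro e
    by_cases h : M.vert (e, true) = M.vert (e, false)
    · rw [h]
    · refine SimpleGraph.ConnectedComponent.sound (SimpleGraph.Adj.reachable ?_)
      exact (SimpleGraph.fromRel_adj _ _ _).2 ⟨h, Or.inl ⟨e, rfl, rfl⟩⟩
  obtain ⟨e, b⟩ := d
  cases b
  · exact key e
  · exact (key e).symm

theorem vertComp_facePerm (M : RotMap V E) (d : E × Bool) :
    M.vertComp (M.vert (M.facePerm d)) = M.vertComp (M.vert d) := by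
  rw [← M.vertComp_otherHalf d]
  refine congrArg M.vertComp ((M.vert_eq_iff _ _).2 ?_)
  exact ⟨1, by simp [facePerm]⟩

theorem vertComp_eq_of_sameCycle [Finite E] (M : RotMap V E) {d d' : E × Bool}
    (h : M.facePerm.SameCycle d d') : M.vertComp (M.vert d) = M.vertComp (M.vert d') := by
  obtain ⟨n, hn⟩ := h.exists_nat_pow_eq
  rw [← hn]
  clear hn h
  induction n with
  | zero => rfl
  | succ n ih => rw [pow_succ', Equiv.Perm.mul_apply, vertComp_facePerm, ih]

/-- The component containing an edge. -/
def edgeComp (M : RotMap V E) (e : E) : M.Component := M.vertComp (M.vert (e, true))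

/-- The component containing a face. -/
def faceComp [Finite E] (M : RotMap V E) : M.Face → M.Component :=
  Sum.elim
    (Quotient.lift (fun d => M.vertComp (M.vert d)) fun _ _ h => M.vertComp_eq_of_sameCycle h)
    fun v => M.vertComp v.1

/-- The Euler characteristic `|V| - |E| + |F|` of a connected component. -/
noncomputable def eulerChar [Finite E] (M : RotMap V E) (C : M.Component) : ℤ :=
  (Nat.card {v : V // M.vertComp v = C} : ℤ) - Nat.card {e : E // M.edgeComp e = C} +
    Nat.card {f : M.Face // M.faceComp f = C}

/-- The nullity `n(M) = e(M) - v(M) + k(M)`. -/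
noncomputable def nullity (M : RotMap V E) : ℤ :=
  (Nat.card E : ℤ) - Nat.card V + Nat.card M.Component

/-- The dual nullity `n*(M) = e(M) - f(M) + k(M)`. -/
noncomputable def dualNullity (M : RotMap V E) : ℤ :=
  (Nat.card E : ℤ) - Nat.card M.Face + Nat.card M.Component

noncomputable instance componentFintype [Finite V] (M : RotMap V E) : Fintype M.Component :=
  have : Finite M.Component := Quot.finite _
  Fintype.ofFinite _

/-- The value of an edge labelling read at a half-edge: the label where the edge is outgoing
(traversed forward), its inverse where the edge is incoming (traversed backward). -/
def signedValue {G : Type*} [Group G] (x : E → G) (d : E × Bool) : G :=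
  if d.2 then x d.1 else (x d.1)⁻¹

/-- The product `y d * y (σ d) * y (σ (σ d)) * ⋯`, once around the cycle of `σ` through `d`. -/
noncomputable def cycleProd {D G : Type*} [Group G] (σ : Equiv.Perm D) (y : D → G) (d : D) : G :=
  ((List.range (Function.minimalPeriod σ d)).map fun k => y ((σ ^ k) d)).prod

/-- A local `G`-flow: around every vertex, in anticlockwise order and from any starting half-edge,
the product of the values is the identity, values on incoming edges being inverted. -/
def IsLocalFlow {G : Type*} [Group G] (M : RotMap V E) (x : E → G) : Prop :=
  ∀ d : E × Bool, cycleProd M.rot (signedValue x) d = 1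

/-- A local `G`-tension: around every face, in anticlockwise order and from any starting edge,
the product of the values is the identity, values on backward edges being inverted. -/
def IsLocalTension {G : Type*} [Group G] (M : RotMap V E) (x : E → G) : Prop :=
  ∀ d : E × Bool, cycleProd M.facePerm (signedValue x) d = 1

/-- The number of nowhere-identity local `G`-flows. -/
noncomputable def numFlows (M : RotMap V E) (G : Type*) [Group G] : ℕ :=
  Nat.card {x : E → G // M.IsLocalFlow x ∧ ∀ e, x e ≠ 1}

/-- The number of nowhere-identity local `G`-tensions. -/
noncomputable def numTensions (M : RotMap V E) (G : Type*) [Group G] : ℕ :=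
  Nat.card {x : E → G // M.IsLocalTension x ∧ ∀ e, x e ≠ 1}

end RotMap

/-! ### Irreducible complex representations -/

/-- The irreducible representations of `G` on `ℂ ^ n`. -/
abbrev IrredRep (G : Type*) [Group G] (n : ℕ) : Type _ :=
  {ρ : Representation ℂ G (Fin n → ℂ) // ρ.IsIrreducible}

/-- Isomorphism of representations. -/
def irredSetoid (G : Type*) [Group G] (n : ℕ) : Setoid (IrredRep G n) where
  r ρ ρ' := Nonempty (ρ.1.Equiv ρ'.1)
  iseqv :=
    { refl := fun ρ => ⟨Representation.Equiv.refl ρ.1⟩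
      symm := fun ⟨f⟩ => ⟨f.symm⟩
      trans := fun ⟨f⟩ ⟨g⟩ => ⟨f.trans g⟩ }

/-- The isomorphism classes of irreducible finite-dimensional complex representations of `G`,
each realized on `ℂ ^ n` for its dimension `n`. -/
def IrrClass (G : Type*) [Group G] : Type _ := Σ n : ℕ, Quotient (irredSetoid G n)

/-- The dimension of an isomorphism class of irreducible representations. -/
def IrrClass.dim {G : Type*} [Group G] (c : IrrClass G) : ℕ := c.1

theorem IrrClass.finite (G : Type*) [Group G] [Finite G] : Finite (IrrClass G) := by
  let R := MonoidAlgebra ℂ G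
  have simple : ∀ (n : ℕ) (ρ : IrredRep G n), IsSimpleModule R ρ.1.asModule := fun n ρ =>
    (Representation.irreducible_iff_isSimpleModule_asModule ρ.1).1 ρ.2
  let F : IrrClass G → isotypicComponents R R := fun c =>
    ⟨isotypicComponent R R c.2.out.1.asModule, by
      have := simple c.1 c.2.out
      obtain ⟨I, ⟨e⟩⟩ := IsSemisimpleRing.exists_linearEquiv_ideal_of_isSimpleModule R
        c.2.out.1.asModule
      have : IsSimpleModule R I := IsSimpleModule.congr e.symm
      exact ⟨I, this, e.isotypicComponent_eq⟩⟩
  refine Finite.of_injective F ?_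
  rintro ⟨n, c⟩ ⟨m, c'⟩ h
  have h1 : isotypicComponent R R c.out.1.asModule = isotypicComponent R R c'.out.1.asModule :=
    congrArg Subtype.val h
  have s1 := simple n c.out
  have s2 := simple m c'.out
  obtain ⟨I, ⟨e⟩⟩ := IsSemisimpleRing.exists_linearEquiv_ideal_of_isSimpleModule R
    c.out.1.asModule
  obtain ⟨J, ⟨e'⟩⟩ := IsSemisimpleRing.exists_linearEquiv_ideal_of_isSimpleModule R
    c'.out.1.asModule
  have sI : IsSimpleModule R I := IsSimpleModule.congr e.symm
  have sJ : IsSimpleModule R J := IsSimpleModule.congr e'.symm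
  rw [e.isotypicComponent_eq, e'.isotypicComponent_eq] at h1
  have hI : I ≤ isotypicComponent R R J := h1 ▸ Submodule.le_isotypicComponent I
  have hiso := IsIsotypicOfType.isotypicComponent (R := R) (M := R) (S := J)
  obtain ⟨f⟩ := (isIsotypicOfType_submodule_iff.1 hiso) I hI
  let g : c.out.1.asModule ≃ₗ[R] c'.out.1.asModule := (e.trans f).trans e'.symm
  let g0 := (Representation.IntertwiningMap.equivLinearMapAsModule c.out.1 c'.out.1).symm
    g.toLinearMap
  have g1 : c.out.1.Equiv c'.out.1 := Representation.IntertwiningMap.ofBijective g0 g.bijective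
  have hnm : n = m := by simpa using g1.toLinearEquiv.finrank_eq
  subst hnm
  have : c = c' := by
    rw [← Quotient.out_eq c, ← Quotient.out_eq c']
    exact Quotient.sound ⟨g1⟩
  rw [this]

noncomputable instance IrrClass.fintype (G : Type*) [Group G] [Finite G] :
    Fintype (IrrClass G) :=
  have := IrrClass.finite G
  Fintype.ofFinite _

end SurfaceMap

namespace SurfaceMap

/-! All local flows are counted first, identity values allowed. The indicator of the identity of `G`
is `1/|G|` times the regular character, that is, times the sum over the irreducibles of dimension
times trace. Insert this for the product around every vertex that carries half-edges and expand the
traces: the count becomes a sum over labellings of the half-edges by matrix indices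
(`prod_trace_cycleProd`). Each edge enters twice, through its value and through the inverse of its
value, so the sum over that value is given by Schur orthogonality (`exists_block_representation`).

The labellings that survive choose one irreducible for each connected component and one of its
matrix indices for each face (`sum_compatible_eq_sum_label`). On a component with an irreducible of
dimension `n`, every vertex gives `n` (the weight of the trace), every edge gives `1/n` (Schur), and
every face gives `n` (the choice of index), hence `n ^ χ` in all. With `|G|` for each edge and
`1/|G|` for each vertex this is `card_localFlow`. An isolated vertex fits in because the squares of
the dimensions sum to `|G|`.

Inclusion–exclusion over the set `B` of edges forced to carry the identity then gives (i): flows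
trivial on `B` are flows of `M \ B`, since deletion only skips factors equal to `1`
(`cycleProd_firstReturn`). For (ii), tensions are flows of the dual, and duality exchanges vertices
with faces while preserving components and Euler characteristics. -/

theorem asAlgebraHom_intertwining {G k V W : Type*} [Monoid G] [Field k] [AddCommGroup V]
    [Module k V] [AddCommGroup W] [Module k W] {ρ : Representation k G V}
    {σ : Representation k G W} (f : ρ.IntertwiningMap σ) (a : MonoidAlgebra k G) (v : V) :
    f (ρ.asAlgebraHom a v) = σ.asAlgebraHom a (f v) := by
  induction a using MonoidAlgebra.induction_on with
  | of g => simpa using Representation.IntertwiningMap.isIntertwining _ _ f g v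
  | add a b ha hb =>
    rw [map_add, map_add, LinearMap.add_apply, LinearMap.add_apply, map_add, ha, hb]
  | smul c a ha => rw [map_smul, map_smul, LinearMap.smul_apply, LinearMap.smul_apply, map_smul, ha]

theorem asAlgebraHom_mem {G k V : Type*} [Monoid G] [Field k] [AddCommGroup V]
    [Module k V] {ρ : Representation k G V} (p : Subrepresentation ρ) (a : MonoidAlgebra k G)
    {v : V} (hv : v ∈ p.toSubmodule) : ρ.asAlgebraHom a v ∈ p.toSubmodule := by
  induction a using MonoidAlgebra.induction_on with
  | of g => simpa using p.apply_mem_toSubmodule g hv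
  | add a b ha hb => rw [map_add, LinearMap.add_apply]; exact add_mem ha hb
  | smul c a ha => rw [map_smul, LinearMap.smul_apply]; exact p.toSubmodule.smul_mem c ha

theorem IrrClass.equiv_of_mk_eq {G : Type*} [Group G] {n m : ℕ} (ρ : IrredRep G n)
    (ρ' : IrredRep G m)
    (h : (⟨n, Quotient.mk _ ρ⟩ : IrrClass G) = ⟨m, Quotient.mk _ ρ'⟩) :
    Nonempty (ρ.1.Equiv ρ'.1) := by
  obtain ⟨rfl, h2⟩ := Sigma.mk.inj_iff.1 h
  exact Quotient.exact (eq_of_heq h2)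

theorem IrrClass.mk_eq_of_equiv {G : Type*} [Group G] {n m : ℕ} (ρ : IrredRep G n)
    (ρ' : IrredRep G m) (f : ρ.1.Equiv ρ'.1) :
    (⟨n, Quotient.mk _ ρ⟩ : IrrClass G) = ⟨m, Quotient.mk _ ρ'⟩ := by
  have hnm : n = m := by simpa using f.toLinearEquiv.finrank_eq
  subst hnm
  have : Quotient.mk (irredSetoid G n) ρ = Quotient.mk _ ρ' := Quotient.sound ⟨f⟩
  rw [this]

/-! ### Wedderburn blocks and irreducible representations -/

section Wedderburn

open Matrix

variable {G ι : Type*} [Group G] [Fintype ι] [DecidableEq ι] {d : ι → ℕ}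
  (φ : MonoidAlgebra ℂ G ≃ₐ[ℂ] Π i, Matrix (Fin (d i)) (Fin (d i)) ℂ)

/-- The action of the group algebra on the column space of one Wedderburn block. -/
noncomputable def blockAlgHom (i : ι) : MonoidAlgebra ℂ G →ₐ[ℂ] Module.End ℂ (Fin (d i) → ℂ) :=
  (Matrix.toLinAlgEquiv' : Matrix (Fin (d i)) (Fin (d i)) ℂ ≃ₐ[ℂ] _).toAlgHom.comp
    ((Pi.evalAlgHom ℂ (fun i => Matrix (Fin (d i)) (Fin (d i)) ℂ) i).comp φ.toAlgHom)

/-- The representation on the column space of one Wedderburn block. -/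
noncomputable def blockRep (i : ι) : Representation ℂ G (Fin (d i) → ℂ) :=
  (MonoidAlgebra.lift ℂ _ G).symm (blockAlgHom φ i)

omit [Fintype ι] [DecidableEq ι] in
theorem blockRep_asAlgebraHom (i : ι) (a : MonoidAlgebra ℂ G) (u : Fin (d i) → ℂ) :
    (blockRep φ i).asAlgebraHom a u = φ a i *ᵥ u := by
  have : (blockRep φ i).asAlgebraHom = blockAlgHom φ i := by
    simp [Representation.asAlgebraHom, blockRep]
  rw [this]
  simp [blockAlgHom, Matrix.toLinAlgEquiv'_apply]

omit [Fintype ι] [DecidableEq ι] in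
theorem blockRep_apply (i : ι) (g : G) (u : Fin (d i) → ℂ) :
    blockRep φ i g u = φ (MonoidAlgebra.of ℂ G g) i *ᵥ u := by
  rw [← blockRep_asAlgebraHom]
  simp

omit [Fintype ι] in
-- A rank-one matrix sends a given nonzero vector to any prescribed vector.
theorem blockRep_isIrreducible (i : ι) (hd : d i ≠ 0) : (blockRep φ i).IsIrreducible := by
  have : Nonempty (Fin (d i)) := ⟨⟨0, Nat.pos_of_ne_zero hd⟩⟩
  have hnt : Nontrivial (Subrepresentation (blockRep φ i)) := by
    refine ⟨⊥, ⊤, fun h => ?_⟩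
    have h2 : (⊥ : Submodule ℂ (Fin (d i) → ℂ)) = ⊤ := congrArg Subrepresentation.toSubmodule h
    exact bot_ne_top h2
  refine ⟨fun p => ?_⟩
  by_cases hp : ∃ u ∈ p.toSubmodule, u ≠ 0
  · right
    obtain ⟨u, hu, hu0⟩ := hp
    obtain ⟨j, hj⟩ := Function.ne_iff.1 hu0
    apply Subrepresentation.toSubmodule_injective
    refine Submodule.eq_top_iff'.2 fun w => ?_
    have h := asAlgebraHom_mem p
      (φ.symm (Pi.single i (vecMulVec w (Pi.single j (u j)⁻¹)))) hu
    rw [blockRep_asAlgebraHom, AlgEquiv.apply_symm_apply, Pi.single_eq_same,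
      vecMulVec_mulVec] at h
    have hj' : u j ≠ 0 := hj
    simpa [hj'] using h
  · left
    push Not at hp
    apply Subrepresentation.toSubmodule_injective
    exact (Submodule.eq_bot_iff _).2 hp

omit [Fintype ι] in
-- The unit of block `i` acts as the identity on the columns of block `i` and as zero on those of
-- block `j`.
theorem blockRep_not_equiv {i j : ι} (hij : i ≠ j) (hd : d i ≠ 0)
    (f : (blockRep φ i).Equiv (blockRep φ j)) : False := by
  have h := asAlgebraHom_intertwining f.toIntertwiningMap (φ.symm (Pi.single i 1))
    (Pi.single ⟨0, Nat.pos_of_ne_zero hd⟩ 1)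
  rw [blockRep_asAlgebraHom, blockRep_asAlgebraHom, AlgEquiv.apply_symm_apply, Pi.single_eq_same,
    Pi.single_eq_of_ne hij.symm, one_mulVec, zero_mulVec] at h
  have h2 := f.toLinearEquiv.map_eq_zero_iff.1 h
  simpa using congrFun h2 ⟨0, Nat.pos_of_ne_zero hd⟩

/-- The unit of the group algebra is the sum of the diagonal matrix units of all blocks, so one of
these does not kill a given `v ≠ 0`. The matrices supported on its column form a copy of the block
representation; letting them act on `v` gives a nonzero intertwining map, bijective by Schur's
lemma. -/
theorem exists_equiv_blockRep (hd : ∀ i, d i ≠ 0) {n : ℕ} (ρ : IrredRep G n) :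
    ∃ i, Nonempty ((blockRep φ i).Equiv ρ.1) := by
  have hirr := ρ.2
  obtain ⟨v, hv⟩ : ∃ v : Fin n → ℂ, v ≠ 0 := by
    by_contra! h
    have hnt : (⊥ : Subrepresentation ρ.1) ≠ ⊤ := bot_ne_top
    apply hnt
    apply Subrepresentation.toSubmodule_injective
    ext v
    rw [h v]
    simp
  have h1 : ∑ i, ∑ j, ρ.1.asAlgebraHom
      (φ.symm (Pi.single i (vecMulVec (Pi.single j 1) (Pi.single j 1)))) v = v := by
    have h2 : ∑ i, ∑ j : Fin (d i), (Pi.single i (vecMulVec (Pi.single j 1) (Pi.single j 1)) :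
        Π i, Matrix (Fin (d i)) (Fin (d i)) ℂ) = 1 := by
      have h3 : ∀ i, ∑ j : Fin (d i), vecMulVec (Pi.single j (1 : ℂ)) (Pi.single j 1) = 1 := by
        intro i
        ext a b
        simp [Matrix.sum_apply, vecMulVec_apply, Pi.single_apply, Matrix.one_apply]
      calc _ = ∑ i, (Pi.single i (1 : Matrix (Fin (d i)) (Fin (d i)) ℂ) :
            Π i, Matrix (Fin (d i)) (Fin (d i)) ℂ) := by
            refine Finset.sum_congr rfl fun i _ => ?_
            rw [← h3 i]
            exact (map_sum (AddMonoidHom.single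
              (fun i => Matrix (Fin (d i)) (Fin (d i)) ℂ) i) _ _).symm
        _ = 1 := Finset.univ_sum_single _
    have h4 := congrArg (fun m => ρ.1.asAlgebraHom (φ.symm m) v) h2
    simpa [map_sum, LinearMap.sum_apply] using h4
  obtain ⟨i, j, hij⟩ : ∃ i, ∃ j : Fin (d i), ρ.1.asAlgebraHom
      (φ.symm (Pi.single i (vecMulVec (Pi.single j 1) (Pi.single j 1)))) v ≠ 0 := by
    by_contra! h
    apply hv
    rw [← h1]
    exact Finset.sum_eq_zero fun i _ => Finset.sum_eq_zero fun j _ => h i j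
  let T : (Fin (d i) → ℂ) →ₗ[ℂ] (Fin n → ℂ) :=
    { toFun := fun u => ρ.1.asAlgebraHom
        (φ.symm (Pi.single i (vecMulVec u (Pi.single j 1)))) v
      map_add' := fun u u' => by
        rw [add_vecMulVec, Pi.single_add, map_add, map_add, LinearMap.add_apply]
      map_smul' := fun c u => by
        rw [smul_vecMulVec, Pi.single_smul, map_smul, map_smul, LinearMap.smul_apply,
          RingHom.id_apply] }
  have hT : ∀ g u, T (blockRep φ i g u) = ρ.1 g (T u) := by
    intro g u
    have h5 : (Pi.single i (vecMulVec (blockRep φ i g u) (Pi.single j 1)) :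
        Π i, Matrix (Fin (d i)) (Fin (d i)) ℂ) =
        φ (MonoidAlgebra.of ℂ G g) * Pi.single i (vecMulVec u (Pi.single j 1)) := by
      rw [blockRep_apply, ← mul_vecMulVec, Pi.single_mul_right]
    change ρ.1.asAlgebraHom (φ.symm _) v = _
    rw [h5, map_mul, AlgEquiv.symm_apply_apply, map_mul, Module.End.mul_apply]
    simp [T]
  have := blockRep_isIrreducible φ i (hd i)
  let T' : (blockRep φ i).IntertwiningMap ρ.1 := ⟨T, fun g => LinearMap.ext (hT g)⟩
  refine ⟨i, ⟨Representation.IntertwiningMap.ofBijective T' ?_⟩⟩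
  refine (Representation.IsIrreducible.bijective_or_eq_zero T').resolve_right fun h0 => hij ?_
  exact congrArg (fun f : (blockRep φ i).IntertwiningMap ρ.1 => f (Pi.single j 1)) h0

/-- The Wedderburn blocks of the group algebra are indexed by the irreducible representations. -/
noncomputable def blockEquivIrrClass (hd : ∀ i, d i ≠ 0) : ι ≃ IrrClass G :=
  Equiv.ofBijective
    (fun i => ⟨d i, Quotient.mk _ ⟨blockRep φ i, blockRep_isIrreducible φ i (hd i)⟩⟩) <| by
    constructor
    · intro i j h
      by_contra hij
      obtain ⟨f⟩ := IrrClass.equiv_of_mk_eq _ _ h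
      exact blockRep_not_equiv φ hij (hd i) f
    · rintro ⟨m, c⟩
      induction c using Quotient.inductionOn with
      | _ ρ =>
        obtain ⟨i, ⟨f⟩⟩ := exists_equiv_blockRep φ hd ρ
        exact ⟨i, IrrClass.mk_eq_of_equiv ⟨_, blockRep_isIrreducible φ i (hd i)⟩ ρ f⟩

end Wedderburn

/-! ### Regular trace and Schur orthogonality -/

section RegularTrace

open Matrix

/-- Left multiplication by `g` permutes the basis of group elements, without fixed points unless `g
= 1`. -/
theorem trace_mulLeft_of {G : Type*} [Group G] [Fintype G] [DecidableEq G] (g : G) :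
    LinearMap.trace ℂ _ (LinearMap.mulLeft ℂ (MonoidAlgebra.of ℂ G g)) =
      if g = 1 then (Nat.card G : ℂ) else 0 := by
  rw [LinearMap.trace_eq_matrix_trace ℂ (MonoidAlgebra.basis G ℂ), Matrix.trace]
  have : ∀ h : G, (LinearMap.toMatrix (MonoidAlgebra.basis G ℂ) (MonoidAlgebra.basis G ℂ)
      (LinearMap.mulLeft ℂ (MonoidAlgebra.of ℂ G g))).diag h = if g = 1 then 1 else 0 := by
    intro h
    rw [Matrix.diag_apply, LinearMap.toMatrix_apply, MonoidAlgebra.basis_apply,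
      LinearMap.mulLeft_apply, MonoidAlgebra.of_apply, MonoidAlgebra.single_mul_single, one_mul,
      ← MonoidAlgebra.basis_apply, Module.Basis.repr_self, Finsupp.single_apply]
    simp
  simp only [this]
  by_cases hg : g = 1 <;> simp [hg]

/-- Left multiplication acts on each of the `d i` columns of block `i` separately, by the same
matrix `m i`. -/
theorem trace_mulLeft_pi_matrix {ι : Type*} [Fintype ι] [DecidableEq ι] {d : ι → ℕ}
    (m : Π i, Matrix (Fin (d i)) (Fin (d i)) ℂ) :
    LinearMap.trace ℂ _ (LinearMap.mulLeft ℂ m) = ∑ i, (d i : ℂ) * ∑ j, m i j j := by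
  let b := Pi.basis fun i => Matrix.stdBasis ℂ (Fin (d i)) (Fin (d i))
  have hb : ∀ i (M : Matrix (Fin (d i)) (Fin (d i)) ℂ) (x : Fin (d i) × Fin (d i)),
      (Matrix.stdBasis ℂ (Fin (d i)) (Fin (d i))).repr M x = M x.1 x.2 := fun _ _ _ => rfl
  rw [LinearMap.trace_eq_matrix_trace ℂ b, Matrix.trace, Fintype.sum_sigma]
  refine Finset.sum_congr rfl fun i _ => ?_
  rw [Fintype.sum_prod_type, Finset.mul_sum]
  refine Finset.sum_congr rfl fun j _ => ?_
  have : ∀ k : Fin (d i), (LinearMap.toMatrix b b (LinearMap.mulLeft ℂ m)).diag ⟨i, (j, k)⟩ =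
      m i j j := by
    intro k
    rw [Matrix.diag_apply, LinearMap.toMatrix_apply, Pi.basis_apply, Pi.basis_repr,
      LinearMap.mulLeft_apply, hb, Pi.mul_apply, Pi.single_eq_same, Matrix.stdBasis_eq_single]
    simp
  rw [Finset.sum_congr rfl fun k _ => this k]
  simp

variable {G ι : Type*} [Group G] [Fintype G] [DecidableEq G] [Fintype ι] [DecidableEq ι]
  {d : ι → ℕ} (φ : MonoidAlgebra ℂ G ≃ₐ[ℂ] Π i, Matrix (Fin (d i)) (Fin (d i)) ℂ)

omit [Fintype G] [DecidableEq G] in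
theorem trace_mulLeft_eq_sum (a : MonoidAlgebra ℂ G) :
    LinearMap.trace ℂ _ (LinearMap.mulLeft ℂ a) = ∑ i, (d i : ℂ) * ∑ j, φ a i j j := by
  rw [← trace_mulLeft_pi_matrix, ← LinearMap.trace_conj' _ φ.toLinearEquiv]
  congr 1
  refine LinearMap.ext fun x => ?_
  simp [LinearEquiv.conj_apply]

/-- Fourier inversion: the regular trace of `a * g⁻¹` picks out `|G|` times the coefficient of `g`
in `a`. By linearity it is enough to test group elements. -/
theorem card_smul_eq_sum_trace (a : MonoidAlgebra ℂ G) :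
    (Nat.card G : ℂ) • a = ∑ g : G,
      LinearMap.trace ℂ _ (LinearMap.mulLeft ℂ (a * MonoidAlgebra.of ℂ G g⁻¹)) •
        MonoidAlgebra.of ℂ G g := by
  have hadd : ∀ a b : MonoidAlgebra ℂ G,
      LinearMap.mulLeft ℂ (a + b) = LinearMap.mulLeft ℂ a + LinearMap.mulLeft ℂ b := by
    intro a b
    refine LinearMap.ext fun x => ?_
    simp [add_mul]
  have hsmul : ∀ (c : ℂ) (a : MonoidAlgebra ℂ G),
      LinearMap.mulLeft ℂ (c • a) = c • LinearMap.mulLeft ℂ a := by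
    intro c a
    refine LinearMap.ext fun x => ?_
    simp
  induction a using MonoidAlgebra.induction_on with
  | of h =>
    simp only [← map_mul, trace_mulLeft_of, mul_inv_eq_one]
    simp [ite_smul]
  | add a b ha hb =>
    simp only [add_mul, hadd, map_add, add_smul, Finset.sum_add_distrib, smul_add, ha, hb]
  | smul c a ha =>
    simp only [smul_mul_assoc, hsmul, map_smul, smul_assoc, ← Finset.smul_sum, ← ha]
    rw [smul_comm]

/-- Schur orthogonality by Fourier inversion: expand the matrix unit at `(e, c)` of block `j` with
`card_smul_eq_sum_trace`. The regular trace of this unit times `g⁻¹` is `d j` times the entry `(c,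
e)` of `g⁻¹` in block `j`; then compare the entries `(a, b)` in block `i`. -/
theorem sum_block_mul_block_inv (hd : ∀ i, d i ≠ 0) (i j : ι) (a b : Fin (d i)) (c e : Fin (d j)) :
    ∑ g : G, φ (MonoidAlgebra.of ℂ G g) i a b * φ (MonoidAlgebra.of ℂ G g⁻¹) j c e =
      (Nat.card G : ℂ) / d j * (Pi.single j (Matrix.single e c 1) :
        Π i, Matrix (Fin (d i)) (Fin (d i)) ℂ) i a b := by
  have h := card_smul_eq_sum_trace (φ.symm (Pi.single j (Matrix.single e c 1)))
  have h1 := congrArg (fun x => φ x i a b) h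
  simp only [map_smul, map_sum, AlgEquiv.apply_symm_apply, Finset.sum_apply, Matrix.sum_apply,
    Pi.smul_apply, Matrix.smul_apply] at h1
  have h2 : ∀ g : G, LinearMap.trace ℂ _ (LinearMap.mulLeft ℂ
      (φ.symm (Pi.single j (Matrix.single e c 1)) * MonoidAlgebra.of ℂ G g⁻¹)) =
      d j * φ (MonoidAlgebra.of ℂ G g⁻¹) j c e := by
    intro g
    rw [trace_mulLeft_eq_sum φ, Finset.sum_eq_single j]
    · rw [map_mul, AlgEquiv.apply_symm_apply, Finset.sum_eq_single e]
      · simp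
      · intro k _ hk
        simp [hk]
      · simp
    · intro k _ hk
      rw [map_mul, AlgEquiv.apply_symm_apply]
      simp [hk]
    · simp
  have hdj : (d j : ℂ) ≠ 0 := Nat.cast_ne_zero.2 (hd j)
  simp only [h2, smul_eq_mul, mul_assoc, ← Finset.mul_sum] at h1
  rw [div_mul_eq_mul_div, h1, mul_div_cancel_left₀ _ hdj]
  exact Finset.sum_congr rfl fun g _ => mul_comm _ _

end RegularTrace

/-- The regular representation in block diagonal form: one block for each irreducible
representation, with the trace formula and the Schur orthogonality relations. -/
theorem exists_block_representation (G : Type*) [Group G] [Fintype G] [DecidableEq G] :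
    ∃ (n : ℕ) (d : Fin n → ℕ) (e : Fin n ≃ IrrClass G)
      (R : G →* Matrix (Σ i, Fin (d i)) (Σ i, Fin (d i)) ℂ),
      (∀ i, d i ≠ 0) ∧ (∀ i, (e i).dim = d i) ∧
      (∀ g, ∑ p, (d p.1 : ℂ) * R g p p = if g = 1 then (Nat.card G : ℂ) else 0) ∧
      ∀ p q r s, ∑ g, R g p q * R g⁻¹ r s =
        if p = s ∧ q = r ∧ p.1 = q.1 then (Nat.card G : ℂ) / d p.1 else 0 := by
  have : NeZero (Nat.card G : ℂ) := ⟨Nat.cast_ne_zero.2 Nat.card_pos.ne'⟩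
  have : FiniteDimensional ℂ (MonoidAlgebra ℂ G) := Module.Finite.of_basis (MonoidAlgebra.basis G ℂ)
  obtain ⟨n, d, hd', ⟨φ⟩⟩ :=
    IsSemisimpleRing.exists_algEquiv_pi_matrix_of_isAlgClosed ℂ (MonoidAlgebra ℂ G)
  have hd : ∀ i, d i ≠ 0 := fun i => (hd' i).out
  let R : G →* Matrix (Σ i, Fin (d i)) (Σ i, Fin (d i)) ℂ :=
    ((Matrix.blockDiagonal'RingHom (fun i => Fin (d i)) ℂ : _ →* _).comp
      (φ : MonoidAlgebra ℂ G →* Π i, Matrix (Fin (d i)) (Fin (d i)) ℂ)).comp (MonoidAlgebra.of ℂ G)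
  have hR : ∀ g i a b, R g ⟨i, a⟩ ⟨i, b⟩ = φ (MonoidAlgebra.of ℂ G g) i a b := fun g i a b =>
    Matrix.blockDiagonal'_apply_eq (φ (MonoidAlgebra.of ℂ G g)) i a b
  have hR0 : ∀ g p q, p.1 ≠ q.1 → R g p q = 0 := fun g ⟨_, a⟩ ⟨_, b⟩ h =>
    Matrix.blockDiagonal'_apply_ne (φ (MonoidAlgebra.of ℂ G g)) a b h
  refine ⟨n, d, blockEquivIrrClass φ hd, R, hd, fun i => rfl, fun g => ?_, ?_⟩
  · rw [← trace_mulLeft_of, trace_mulLeft_eq_sum φ, Fintype.sum_sigma]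
    simp only [hR, Finset.mul_sum]
  · rintro ⟨i, a⟩ ⟨i', b⟩ ⟨j, c⟩ ⟨j', e⟩
    by_cases hi : i = i'
    · subst hi
      by_cases hj : j = j'
      · subst hj
        simp only [hR, sum_block_mul_block_inv φ hd]
        by_cases hij : i = j
        · subst hij
          simp [Matrix.single_apply, eq_comm]
        · simp [hij]
      · have h0 : ∀ g, R g ⟨j, c⟩ ⟨j', e⟩ = 0 := fun g => hR0 _ _ _ hj
        simp only [h0, mul_zero, Finset.sum_const_zero]
        rw [if_neg]
        rintro ⟨h1, h2, -⟩
        exact hj ((congrArg Sigma.fst h2).symm.trans (congrArg Sigma.fst h1))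
    · have h0 : ∀ g, R g ⟨i, a⟩ ⟨i', b⟩ = 0 := fun g => hR0 _ _ _ hi
      simp [h0, hi]

namespace RotMap

/-! ### Products around cycles and induced permutations -/

section Cycles

variable {D : Type*} [Finite D] (σ : Equiv.Perm D)

theorem minimalPeriod_perm_pos (d : D) : 0 < Function.minimalPeriod σ d :=
  Function.minimalPeriod_pos_of_mem_periodicPts (σ.injective.mem_periodicPts d)

omit [Finite D] in
theorem pow_minimalPeriod_apply (d : D) : (σ ^ Function.minimalPeriod σ d) d = d := by
  rw [← Equiv.Perm.iterate_eq_pow]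
  exact Function.iterate_minimalPeriod

variable {G : Type*} [Group G]

/-- The product of the values `y` along the first `n` points of the `σ`-orbit of `d`. -/
def orbitProd {D : Type*} (σ : Equiv.Perm D) (y : D → G) (n : ℕ) (d : D) : G :=
  ((List.range n).map fun k => y ((σ ^ k) d)).prod

omit [Finite D] in
theorem orbitProd_add (y : D → G) (m n : ℕ) (d : D) :
    orbitProd σ y (m + n) d = orbitProd σ y m d * orbitProd σ y n ((σ ^ m) d) := by
  unfold orbitProd
  rw [List.range_add, List.map_append, List.prod_append, List.map_map]
  congr 3
  ext k
  rw [Function.comp_apply, add_comm, pow_add, Equiv.Perm.mul_apply]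

omit [Finite D] in
theorem orbitProd_one (y : D → G) (d : D) : orbitProd σ y 1 d = y d := by
  simp [orbitProd]

/-- From the product along one step more than a full turn, split off either the first or the last
factor; both are `y d`. -/
theorem cycleProd_apply (y : D → G) (d : D) :
    cycleProd σ y (σ d) = (y d)⁻¹ * cycleProd σ y d * y d := by
  have hper : Function.minimalPeriod σ (σ d) = Function.minimalPeriod σ d :=
    Function.minimalPeriod_apply (σ.injective.mem_periodicPts d)
  have h1 : cycleProd σ y (σ d) = orbitProd σ y (Function.minimalPeriod σ d) (σ d) := by
    rw [← hper]; rfl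
  have h2 : cycleProd σ y d = orbitProd σ y (Function.minimalPeriod σ d) d := rfl
  have h3 := orbitProd_add σ y 1 (Function.minimalPeriod σ d) d
  have h4 := orbitProd_add σ y (Function.minimalPeriod σ d) 1 d
  rw [pow_minimalPeriod_apply, orbitProd_one] at h4
  rw [add_comm, h4, orbitProd_one, pow_one] at h3
  rw [h1, h2, mul_assoc, h3, inv_mul_cancel_left]

theorem cycleProd_eq_one_iff_of_sameCycle (y : D → G) {d d' : D} (h : σ.SameCycle d d') :
    cycleProd σ y d = 1 ↔ cycleProd σ y d' = 1 := by
  obtain ⟨n, rfl⟩ := h.exists_nat_pow_eq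
  clear h
  induction n with
  | zero => rfl
  | succ n ih =>
    rw [ih, pow_succ', Equiv.Perm.mul_apply, cycleProd_apply]
    constructor
    · intro h
      simp [h]
    · intro h
      rw [mul_assoc, inv_mul_eq_one] at h
      simpa using h.symm

omit [Finite D] in
theorem cycleProd_permCongr {D' : Type*} (f : D ≃ D') (y : D' → G) (d : D) :
    cycleProd (f.permCongr σ) y (f d) = cycleProd σ (fun x => y (f x)) d := by
  have hp : ∀ n : ℕ, ((f.permCongr σ) ^ n) (f d) = f ((σ ^ n) d) := by
    intro n
    rw [← Equiv.permCongrHom_coe, ← map_pow]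
    simp
  have hper : Function.minimalPeriod (f.permCongr σ) (f d) = Function.minimalPeriod σ d := by
    rw [Function.minimalPeriod_eq_minimalPeriod_iff]
    intro n
    simp only [Function.IsPeriodicPt, Function.IsFixedPt, Equiv.Perm.iterate_eq_pow, hp,
      f.injective.eq_iff]
  simp only [cycleProd, hper, hp]

section FirstReturn

variable (p : D → Prop)

/-- The time of the `j`-th return of the orbit of `d` to `p`. -/
noncomputable def iteratedReturnTime (d : {d // p d}) (j : ℕ) : ℕ :=
  ∑ i ∈ Finset.range j, returnTime σ p ((firstReturn σ p ^ i) d)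

theorem iteratedReturnTime_succ (d : {d // p d}) (j : ℕ) :
    iteratedReturnTime σ p d (j + 1) =
      iteratedReturnTime σ p d j + returnTime σ p ((firstReturn σ p ^ j) d) :=
  Finset.sum_range_succ _ _

theorem iteratedReturnTime_strictMono (d : {d // p d}) :
    StrictMono (iteratedReturnTime σ p d) :=
  strictMono_nat_of_lt_succ fun j => by
    rw [iteratedReturnTime_succ]
    exact Nat.lt_add_of_pos_right (returnTime_pos _ _ _)

theorem firstReturn_pow_apply (d : {d // p d}) (j : ℕ) :
    ((firstReturn σ p ^ j) d).1 = (σ ^ iteratedReturnTime σ p d j) d.1 := by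
  induction j with
  | zero => rfl
  | succ j ih =>
    rw [pow_succ', Equiv.Perm.mul_apply, firstReturn_apply, ih, iteratedReturnTime_succ,
      add_comm, pow_add, Equiv.Perm.mul_apply]

/-- The return times increase strictly, so `m` lies between two consecutive ones; strictly between
them it would contradict the minimality of the next return. -/
theorem exists_iteratedReturnTime_eq (d : {d // p d}) (m : ℕ) (hm : p ((σ ^ m) d.1)) :
    ∃ j, iteratedReturnTime σ p d j = m := by
  obtain ⟨j, hj1, hj2⟩ : ∃ j, iteratedReturnTime σ p d j ≤ m ∧
      m < iteratedReturnTime σ p d (j + 1) := by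
    clear hm
    induction m with
    | zero =>
      exact ⟨0, le_rfl, lt_of_le_of_lt (Nat.zero_le _)
        (iteratedReturnTime_strictMono σ p d Nat.zero_lt_one)⟩
    | succ m ih =>
      obtain ⟨j, h1, h2⟩ := ih
      rcases Nat.lt_or_ge (m + 1) (iteratedReturnTime σ p d (j + 1)) with h | h
      · exact ⟨j, by omega, h⟩
      · exact ⟨j + 1, h, lt_of_le_of_lt (Nat.succ_le_of_lt h2)
          (iteratedReturnTime_strictMono σ p d (Nat.lt_succ_self _))⟩
  refine ⟨j, ?_⟩
  by_contra hne
  have hpos : 0 < m - iteratedReturnTime σ p d j := by omega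
  have hle := returnTime_le σ p ((firstReturn σ p ^ j) d) hpos (by
    rw [firstReturn_pow_apply, ← Equiv.Perm.mul_apply, ← pow_add, Nat.sub_add_cancel hj1]
    exact hm)
  rw [iteratedReturnTime_succ] at hj2
  omega

/-- One turn of the induced permutation takes exactly one turn of `σ`: the period of `σ` is itself a
return time, and its index is a period of the induced permutation. -/
theorem iteratedReturnTime_minimalPeriod (d : {d // p d}) :
    iteratedReturnTime σ p d (Function.minimalPeriod (firstReturn σ p) d) =
      Function.minimalPeriod σ d.1 := by
  apply le_antisymm
  · obtain ⟨j, hj⟩ := exists_iteratedReturnTime_eq σ p d (Function.minimalPeriod σ d.1)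
      (by rw [pow_minimalPeriod_apply]; exact d.2)
    rw [← hj]
    refine (iteratedReturnTime_strictMono σ p d).monotone ?_
    refine Function.IsPeriodicPt.minimalPeriod_le ?_ ?_
    · rcases Nat.eq_zero_or_pos j with rfl | h
      · have := minimalPeriod_perm_pos σ d.1
        have h0 : iteratedReturnTime σ p d 0 = 0 := rfl
        omega
      · exact h
    · change (firstReturn σ p)^[j] d = d
      rw [Equiv.Perm.iterate_eq_pow]
      apply Subtype.ext
      rw [firstReturn_pow_apply, hj, pow_minimalPeriod_apply]
  · refine Function.IsPeriodicPt.minimalPeriod_le ?_ ?_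
    · exact lt_of_le_of_lt (Nat.zero_le _)
        (iteratedReturnTime_strictMono σ p d (minimalPeriod_perm_pos _ d))
    · change σ^[_] d.1 = d.1
      rw [Equiv.Perm.iterate_eq_pow, ← firstReturn_pow_apply, pow_minimalPeriod_apply]

/-- Every point passed strictly between two visits to `p` lies outside `p` and contributes the
factor `1`. -/
theorem orbitProd_returnTime {y : D → G} (hy : ∀ d, ¬ p d → y d = 1) (d : {d // p d}) :
    orbitProd σ y (returnTime σ p d) d.1 = y d.1 := by
  have key : ∀ n, n < returnTime σ p d → orbitProd σ y (n + 1) d.1 = y d.1 := by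
    intro n hn
    induction n with
    | zero => exact orbitProd_one σ y d.1
    | succ n ih =>
      rw [orbitProd_add, ih (by omega), orbitProd_one, hy ((σ ^ (n + 1)) d.1), mul_one]
      intro hp
      have := returnTime_le σ p d (Nat.succ_pos n) hp
      omega
  have hpos := returnTime_pos σ p d
  have := key (returnTime σ p d - 1) (by omega)
  rwa [Nat.sub_add_cancel hpos] at this

theorem orbitProd_firstReturn {y : D → G} (hy : ∀ d, ¬ p d → y d = 1) (d : {d // p d}) (j : ℕ) :
    orbitProd (firstReturn σ p) (fun x => y x.1) j d =
      orbitProd σ y (iteratedReturnTime σ p d j) d.1 := by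
  induction j with
  | zero => rfl
  | succ j ih =>
    rw [orbitProd_add, ih, iteratedReturnTime_succ, orbitProd_add, orbitProd_one,
      ← firstReturn_pow_apply, orbitProd_returnTime σ p hy]

theorem cycleProd_firstReturn {y : D → G} (hy : ∀ d, ¬ p d → y d = 1) (d : {d // p d}) :
    cycleProd (firstReturn σ p) (fun x => y x.1) d = cycleProd σ y d.1 := by
  refine (orbitProd_firstReturn σ p hy d _).trans ?_
  rw [iteratedReturnTime_minimalPeriod]
  rfl

end FirstReturn

end Cycles

/-! ### Traces around cycles as sums over labellings -/

section TraceFormula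

open Finset

variable {I : Type*} [Fintype I] [DecidableEq I]

/-- Sum over paths of indices. The endpoint `q` is kept out of the path `a`, so that setting `q = p`
later closes it up without a repeated index. -/
theorem list_prod_range_apply (M : ℕ → Matrix I I ℂ) (n : ℕ) (p q : I) :
    ((List.range (n + 1)).map M).prod p q = ∑ a : Fin (n + 1) → I,
      if a 0 = p then (∏ k : Fin n, M k (a k.castSucc) (a k.succ)) * M n (a (Fin.last n)) q
      else 0 := by
  induction n generalizing M p with
  | zero =>
    rw [← (Equiv.funUnique (Fin 1) I).symm.sum_comp]
    simp
  | succ n ih =>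
    rw [List.range_succ_eq_map, List.map_cons, List.prod_cons, Matrix.mul_apply, List.map_map]
    simp only [ih, Finset.mul_sum]
    rw [Finset.sum_comm]
    conv_rhs =>
      rw [← (Fin.consEquiv fun _ : Fin (n + 2) => I).sum_comp, Fintype.sum_prod_type,
        Finset.sum_comm]
    refine Finset.sum_congr rfl fun a _ => ?_
    simp [Fin.consEquiv, Fin.prod_univ_succ, ← Fin.succ_last, mul_assoc, -Fin.castSucc_succ,
      ← Fin.succ_castSucc]

/-- The sum `k + 1` is taken in `Fin (n + 1)`, so the last factor leads back to `a 0`. -/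
theorem sum_mul_list_prod_diag (w : I → ℂ) (M : ℕ → Matrix I I ℂ) (n : ℕ) :
    ∑ p, w p * ((List.range (n + 1)).map M).prod p p = ∑ a : Fin (n + 1) → I,
      w (a 0) * ∏ k : Fin (n + 1), M k (a k) (a (k + 1)) := by
  simp only [list_prod_range_apply, Finset.mul_sum]
  rw [Finset.sum_comm]
  refine Finset.sum_congr rfl fun a _ => ?_
  rw [Fin.prod_univ_castSucc]
  simp

end TraceFormula

section CycleCoordinates

variable {D : Type*} [Finite D] (σ : Equiv.Perm D)

/-- Each point is determined by its cycle and its position on that cycle. -/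
noncomputable def cycleCoord :
    (Σ q : Quotient (Equiv.Perm.SameCycle.setoid σ),
      Fin (Function.minimalPeriod σ q.out - 1 + 1)) ≃ D :=
  Equiv.ofBijective (fun x => (σ ^ (x.2 : ℕ)) x.1.out) <| by
    have hmk : ∀ (q : Quotient (Equiv.Perm.SameCycle.setoid σ)) (n : ℕ),
        (Quotient.mk (Equiv.Perm.SameCycle.setoid σ) ((σ ^ n) q.out)) = q := by
      intro q n
      conv_rhs => rw [← Quotient.out_eq q]
      exact Quotient.sound (Equiv.Perm.sameCycle_pow_left.2 (Equiv.Perm.SameCycle.refl _ _))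
    constructor
    · rintro ⟨q, k⟩ ⟨q', k'⟩ h
      have hq : q = q' := by
        rw [← hmk q k, ← hmk q' k']
        exact congrArg _ h
      subst hq
      have hpos := minimalPeriod_perm_pos σ q.out
      have hk : (k : ℕ) = k' := by
        apply Function.iterate_injOn_Iio_minimalPeriod (f := σ) (x := q.out)
        · have := k.2
          simp only [Set.mem_Iio]
          omega
        · have := k'.2
          simp only [Set.mem_Iio]
          omega
        · simpa only [Equiv.Perm.iterate_eq_pow] using h
      rw [Fin.ext hk]
    · intro d
      have hs : σ.SameCycle (Quotient.mk (Equiv.Perm.SameCycle.setoid σ) d).out d :=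
        Quotient.mk_out (s := Equiv.Perm.SameCycle.setoid σ) d
      obtain ⟨n, hn⟩ := hs.exists_nat_pow_eq
      refine ⟨⟨Quotient.mk _ d, ⟨n % Function.minimalPeriod σ
        (Quotient.mk (Equiv.Perm.SameCycle.setoid σ) d).out, ?_⟩⟩, ?_⟩
      · have hpos := minimalPeriod_perm_pos σ
          (Quotient.mk (Equiv.Perm.SameCycle.setoid σ) d).out
        have := Nat.mod_lt n hpos
        omega
      · dsimp only
        rw [← Equiv.Perm.iterate_eq_pow, Function.iterate_mod_minimalPeriod_eq,
          Equiv.Perm.iterate_eq_pow]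
        exact hn

theorem cycleCoord_apply (q : Quotient (Equiv.Perm.SameCycle.setoid σ))
    (k : Fin (Function.minimalPeriod σ q.out - 1 + 1)) :
    cycleCoord σ ⟨q, k⟩ = (σ ^ (k : ℕ)) q.out := rfl

/-- The period is positive, so `period - 1 + 1` is the period; written this way, `Fin` has a zero
and a cyclic successor, which matches `σ` at the end of the cycle too. -/
theorem apply_cycleCoord (q : Quotient (Equiv.Perm.SameCycle.setoid σ))
    (k : Fin (Function.minimalPeriod σ q.out - 1 + 1)) :
    σ (cycleCoord σ ⟨q, k⟩) = cycleCoord σ ⟨q, k + 1⟩ := by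
  have hpos := minimalPeriod_perm_pos σ q.out
  rw [cycleCoord_apply, cycleCoord_apply, ← Equiv.Perm.mul_apply, ← pow_succ', Fin.val_add_one]
  split_ifs with h
  · subst h
    rw [Fin.val_last, Nat.sub_add_cancel hpos, pow_minimalPeriod_apply, pow_zero,
      Equiv.Perm.one_apply]
  · rfl

/-- The product of the weighted traces of a matrix representation around the cycles of a
permutation is a sum over index labellings. -/
theorem prod_trace_cycleProd {G I : Type*} [Group G] [Fintype D] [Fintype I] [DecidableEq I]
    [Fintype (Quotient (Equiv.Perm.SameCycle.setoid σ))] [DecidableEq D]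
    (R : G →* Matrix I I ℂ) (y : D → G) (w : I → ℂ) :
    ∏ q : Quotient (Equiv.Perm.SameCycle.setoid σ),
        ∑ p, w p * R (cycleProd σ y q.out) p p =
      ∑ a : D → I, (∏ q : Quotient (Equiv.Perm.SameCycle.setoid σ), w (a q.out)) *
        ∏ d, R (y d) (a d) (a (σ d)) := by
  classical
  have h1 : ∀ q : Quotient (Equiv.Perm.SameCycle.setoid σ),
      ∑ p, w p * R (cycleProd σ y q.out) p p =
        ∑ a : Fin (Function.minimalPeriod σ q.out - 1 + 1) → I,
          w (a 0) * ∏ k, R (y (cycleCoord σ ⟨q, k⟩)) (a k) (a (k + 1)) := by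
    intro q
    have hpos := minimalPeriod_perm_pos σ q.out
    have h2 : R (cycleProd σ y q.out) =
        ((List.range (Function.minimalPeriod σ q.out - 1 + 1)).map
          fun k => R (y ((σ ^ k) q.out))).prod := by
      rw [cycleProd, map_list_prod, List.map_map, Nat.sub_add_cancel hpos]
      rfl
    rw [h2, sum_mul_list_prod_diag]
    rfl
  have h0 : ∀ q : Quotient (Equiv.Perm.SameCycle.setoid σ), q.out = cycleCoord σ ⟨q, 0⟩ := by
    intro q
    rw [cycleCoord_apply, Fin.val_zero, pow_zero, Equiv.Perm.one_apply]
  simp only [h1]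
  -- Distributing the product gives one index labelling for each cycle; currying and the cycle
  -- coordinates glue them into a single labelling of `D`.
  rw [Finset.prod_univ_sum, Fintype.piFinset_univ,
    ← ((Equiv.piCurry fun (q : Quotient (Equiv.Perm.SameCycle.setoid σ))
        (_ : Fin (Function.minimalPeriod σ q.out - 1 + 1)) => I).symm.trans
      ((cycleCoord σ).arrowCongr (Equiv.refl I))).sum_comp]
  refine Finset.sum_congr rfl fun a _ => ?_
  have ha : ∀ q k, ((Equiv.piCurry fun (q : Quotient (Equiv.Perm.SameCycle.setoid σ))
      (_ : Fin (Function.minimalPeriod σ q.out - 1 + 1)) => I).symm.trans ((cycleCoord σ).arrowCongr (Equiv.refl I))) a (cycleCoord σ ⟨q, k⟩) =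
      a q k := by
    intro q k
    change a ((cycleCoord σ).symm (cycleCoord σ ⟨q, k⟩)).1 _ = _
    rw [Equiv.symm_apply_apply]
  rw [Finset.prod_mul_distrib, ← (cycleCoord σ).prod_comp, Fintype.prod_sigma]
  congr 1
  · refine Finset.prod_congr rfl fun q _ => ?_
    conv_rhs => rw [h0 q, ha]
  · refine Finset.prod_congr rfl fun q _ => Finset.prod_congr rfl fun k _ => ?_
    rw [apply_cycleCoord, ha, ha]

end CycleCoordinates

/-! ### Labels on components, vertices and faces -/

section Components

variable {V E : Type*} (M : RotMap V E)

theorem exists_component_lift {X : Type*} (μ : V → X)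
    (h : ∀ e, μ (M.vert (e, true)) = μ (M.vert (e, false))) :
    ∃ l : M.Component → X, ∀ v, l (M.vertComp v) = μ v := by
  refine ⟨SimpleGraph.ConnectedComponent.lift μ fun u v p hp => ?_, fun v => rfl⟩
  clear hp
  induction p with
  | nil => rfl
  | cons hadj _ ih =>
    rw [← ih]
    obtain ⟨-, ⟨e, rfl, rfl⟩ | ⟨e, rfl, rfl⟩⟩ := (SimpleGraph.fromRel_adj _ _ _).1 hadj
    · exact h e
    · exact (h e).symm

theorem eq_of_sameCycle {D X : Type*} {σ : Equiv.Perm D} [Finite D] {h : D → X}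
    (hσ : ∀ d, h (σ d) = h d) {d d' : D} (hd : σ.SameCycle d d') : h d = h d' := by
  obtain ⟨n, rfl⟩ := hd.exists_nat_pow_eq
  clear hd
  induction n with
  | zero => rfl
  | succ n ih => rw [pow_succ', Equiv.Perm.mul_apply, hσ, ih]

/-- Invariance under the rotation lets `h` descend to the vertices, and invariance under `otherHalf`
makes it constant along edges. Isolated vertices are components by themselves, so `h'` is
unconstrained. -/
theorem exists_component_label [Finite E] {X : Type*} (h : E × Bool → X)
    (hrot : ∀ d, h (M.rot d) = h d) (hother : ∀ d, h (otherHalf E d) = h d)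
    (h' : {v : V // v ∉ Set.range M.vert} → X) :
    ∃ l : M.Component → X, (∀ d, l (M.vertComp (M.vert d)) = h d) ∧
      ∀ v, l (M.vertComp v.1) = h' v := by
  classical
  let μ : V → X := fun v => if hv : v ∈ Set.range M.vert then h hv.choose else h' ⟨v, hv⟩
  have hμ : ∀ d, μ (M.vert d) = h d := by
    intro d
    have hd : M.vert d ∈ Set.range M.vert := ⟨d, rfl⟩
    rw [show μ (M.vert d) = h hd.choose from dif_pos hd]
    exact eq_of_sameCycle hrot ((M.vert_eq_iff _ _).1 hd.choose_spec)
  have hμ' : ∀ v : {v : V // v ∉ Set.range M.vert}, μ v.1 = h' v := fun v => dif_neg v.2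
  obtain ⟨l, hl⟩ := M.exists_component_lift μ fun e => by
    rw [hμ, hμ]
    exact hother (e, false)
  exact ⟨l, fun d => by rw [hl, hμ], fun v => by rw [hl, hμ']⟩

/-- Hence a labelling of the components can be recovered from the labels of the faces. -/
theorem faceComp_surjective [Finite E] : Function.Surjective M.faceComp := by
  intro C
  induction C using SimpleGraph.ConnectedComponent.ind with
  | _ v =>
    by_cases hv : v ∈ Set.range M.vert
    · obtain ⟨d, rfl⟩ := hv
      exact ⟨Sum.inl (Quotient.mk _ d), rfl⟩
    · exact ⟨Sum.inr ⟨v, hv⟩, rfl⟩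

/-- The vertices are the cycles of the rotation and the isolated vertices. -/
noncomputable def vertexEquiv :
    Quotient (Equiv.Perm.SameCycle.setoid M.rot) ⊕ {v : V // v ∉ Set.range M.vert} ≃ V :=
  Equiv.ofBijective (Sum.elim (fun q => M.vert q.out) Subtype.val) <| by
    constructor
    · rintro (q | v) (q' | v') h
      · have h2 := (M.vert_eq_iff _ _).1 h
        rw [← Quotient.out_eq q, ← Quotient.out_eq q']
        exact congrArg _ (Quotient.sound h2)
      · exact absurd ⟨_, h⟩ v'.2
      · exact absurd ⟨_, h.symm⟩ v.2
      · exact congrArg _ (Subtype.ext h)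
    · intro v
      by_cases hv : v ∈ Set.range M.vert
      · obtain ⟨d, rfl⟩ := hv
        refine ⟨Sum.inl (Quotient.mk _ d), (M.vert_eq_iff _ _).2 ?_⟩
        exact Quotient.mk_out (s := Equiv.Perm.SameCycle.setoid M.rot) d
      · exact ⟨Sum.inr ⟨v, hv⟩, rfl⟩

theorem vertexEquiv_inl (q : Quotient (Equiv.Perm.SameCycle.setoid M.rot)) :
    M.vertexEquiv (Sum.inl q) = M.vert q.out := rfl

theorem vertexEquiv_inr (v : {v : V // v ∉ Set.range M.vert}) :
    M.vertexEquiv (Sum.inr v) = v.1 := rfl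

theorem otherHalf_otherHalf (d : E × Bool) : otherHalf E (otherHalf E d) = d :=
  Prod.ext rfl (Bool.not_not d.2)

theorem facePerm_apply (d : E × Bool) : M.facePerm d = M.rot⁻¹ (otherHalf E d) := rfl

theorem facePerm_otherHalf_rot (d : E × Bool) : M.facePerm (otherHalf E (M.rot d)) = d := by
  rw [facePerm_apply, otherHalf_otherHalf, ← Equiv.Perm.mul_apply, inv_mul_cancel, Equiv.Perm.one_apply]

theorem isLocalFlow_iff [Finite E] {G : Type*} [Group G] (x : E → G) :
    M.IsLocalFlow x ↔ ∀ q : Quotient (Equiv.Perm.SameCycle.setoid M.rot),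
      cycleProd M.rot (signedValue x) q.out = 1 := by
  refine ⟨fun h q => h _, fun h d => ?_⟩
  refine (cycleProd_eq_one_iff_of_sameCycle M.rot _ ?_).1 (h (Quotient.mk _ d))
  exact Quotient.mk_out (s := Equiv.Perm.SameCycle.setoid M.rot) d

end Components
theorem prod_comp_eq_prod_pow_card {X Y K : Type*} [Fintype X] [Fintype Y] [CommMonoid K]
    (c : X → Y) (f : Y → K) : ∏ x, f (c x) = ∏ y, f y ^ Nat.card {x // c x = y} := by
  classical
  rw [← Finset.prod_fiberwise_of_maps_to (g := c) (fun x _ => Finset.mem_univ (c x))]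
  refine Finset.prod_congr rfl fun y _ => ?_
  rw [Finset.prod_congr rfl (g := fun _ => f y) (fun x hx => by rw [(Finset.mem_filter.1 hx).2]),
    Finset.prod_const, Nat.card_eq_fintype_card, Fintype.card_subtype]

/-! ### Counting local flows -/

section Count

variable {V E : Type*} (M : RotMap V E)

/-- An index labelling of the half-edges whose term in the expanded character sum survives Schur
orthogonality. -/
def IsCompatible {ι : Type*} {F : ι → Type*} (a : E × Bool → Σ i, F i) : Prop :=
  ∀ e, a (e, true) = a (M.rot (e, false)) ∧ a (M.rot (e, true)) = a (e, false) ∧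
    (a (e, true)).1 = (a (M.rot (e, true))).1

variable {G : Type*} [Group G] [Fintype G] [DecidableEq G] {ι : Type*} [Fintype ι]
  [DecidableEq ι] {d : ι → ℕ} {R : G →* Matrix (Σ i, Fin (d i)) (Σ i, Fin (d i)) ℂ}

open Classical in
-- Each rotation cycle brings `1/|G|` from the indicator of the identity, and each edge brings
-- `|G|/d` from Schur orthogonality. Isolated vertices impose no condition and do not appear yet.
theorem card_localFlow_eq_sum_compatible [Fintype E]
    (htr : ∀ g, ∑ p, (d p.1 : ℂ) * R g p p = if g = 1 then (Nat.card G : ℂ) else 0)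
    (horth : ∀ p q r s, ∑ g, R g p q * R g⁻¹ r s =
        if p = s ∧ q = r ∧ p.1 = q.1 then (Nat.card G : ℂ) / d p.1 else 0) :
    (Nat.card {x : E → G // M.IsLocalFlow x} : ℂ) =
      ((Nat.card G : ℂ)⁻¹ ^ Nat.card (Quotient (Equiv.Perm.SameCycle.setoid M.rot))) *
      (Nat.card G : ℂ) ^ Nat.card E *
      ∑ a : E × Bool → Σ i, Fin (d i), if M.IsCompatible a then
        (∏ q : Quotient (Equiv.Perm.SameCycle.setoid M.rot), (d (a q.out).1 : ℂ)) *
          (∏ e, (d (a (e, true)).1 : ℂ)⁻¹) else 0 := by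
  have hind : ∀ g : G, (if g = 1 then (1 : ℂ) else 0) =
      (Nat.card G : ℂ)⁻¹ * ∑ p, (d p.1 : ℂ) * R g p p := by
    intro g
    rw [htr]
    split_ifs <;> simp
  have h1 : (Nat.card {x : E → G // M.IsLocalFlow x} : ℂ) =
      ∑ x : E → G, if M.IsLocalFlow x then (1 : ℂ) else 0 := by
    rw [Nat.card_eq_fintype_card, Fintype.card_subtype, Finset.sum_boole]
  have h2 : ∀ x : E → G, (if M.IsLocalFlow x then (1 : ℂ) else 0) =
      (Nat.card G : ℂ)⁻¹ ^ Nat.card (Quotient (Equiv.Perm.SameCycle.setoid M.rot)) *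
      ∑ a : E × Bool → Σ i, Fin (d i),
        (∏ q : Quotient (Equiv.Perm.SameCycle.setoid M.rot), (d (a q.out).1 : ℂ)) *
          ∏ e, (R (x e) (a (e, true)) (a (M.rot (e, true))) *
            R (x e)⁻¹ (a (e, false)) (a (M.rot (e, false)))) := by
    intro x
    have h3 : (if M.IsLocalFlow x then (1 : ℂ) else 0) =
        ∏ q : Quotient (Equiv.Perm.SameCycle.setoid M.rot),
          if cycleProd M.rot (signedValue x) q.out = 1 then (1 : ℂ) else 0 := by
      rw [Finset.prod_ite_zero, Finset.prod_const_one]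
      simp only [isLocalFlow_iff, Finset.mem_univ, forall_true_left]
    rw [h3]
    simp only [hind]
    rw [Finset.prod_mul_distrib, Finset.prod_const, Finset.card_univ, ← Nat.card_eq_fintype_card,
      prod_trace_cycleProd M.rot R (signedValue x) fun p => (d p.1 : ℂ)]
    congr 1
    refine Finset.sum_congr rfl fun a _ => ?_
    rw [Fintype.prod_prod_type]
    simp only [Fintype.prod_bool]
    rfl
  rw [h1]
  simp only [h2]
  rw [← Finset.mul_sum, mul_assoc, Finset.sum_comm]
  congr 1
  rw [Finset.mul_sum]
  refine Finset.sum_congr rfl fun a _ => ?_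
  rw [← Finset.mul_sum]
  -- The values on different edges are independent, so the sum over labellings factors over the
  -- edges.
  have h4 : ∑ x : E → G, ∏ e, (R (x e) (a (e, true)) (a (M.rot (e, true))) *
      R (x e)⁻¹ (a (e, false)) (a (M.rot (e, false)))) =
      ∏ e, ∑ g : G, R g (a (e, true)) (a (M.rot (e, true))) *
        R g⁻¹ (a (e, false)) (a (M.rot (e, false))) := by
    rw [Finset.prod_univ_sum, Fintype.piFinset_univ]
  rw [h4]
  simp only [horth]
  rw [Finset.prod_ite_zero]
  simp only [Finset.mem_univ, forall_true_left]
  by_cases ha : M.IsCompatible a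
  · rw [if_pos ha, if_pos (by exact ha)]
    simp only [div_eq_mul_inv]
    rw [Finset.prod_mul_distrib, Finset.prod_const, Finset.card_univ, Nat.card_eq_fintype_card (α := E)]
    ring
  · rw [if_neg ha, if_neg (by exact ha)]
    simp

open Classical in
-- Compatibility says that `h ↦ a (otherHalf E h)` is invariant under face tracing and that the
-- block of `a` is constant on components. The second factor on the left supplies the labels of the
-- faces at isolated vertices, which carry no half-edge.
theorem sum_compatible_eq_sum_label [Fintype E] [Fintype M.Face]
    [Fintype {v : V // v ∉ Set.range M.vert}] [Fintype V] :
    (∑ a : E × Bool → Σ i, Fin (d i), if M.IsCompatible a then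
        (∏ q : Quotient (Equiv.Perm.SameCycle.setoid M.rot), (d (a q.out).1 : ℂ)) *
          (∏ e, (d (a (e, true)).1 : ℂ)⁻¹) else 0) *
      ∑ a' : {v : V // v ∉ Set.range M.vert} → Σ i, Fin (d i), ∏ v, (d (a' v).1 : ℂ) =
    ∑ l : M.Component → ι, ∑ b : M.Face → Σ i, Fin (d i),
      if ∀ f, (b f).1 = l (M.faceComp f) then
        (∏ v, (d (l (M.vertComp v)) : ℂ)) * ∏ e, (d (l (M.edgeComp e)) : ℂ)⁻¹ else 0 := by
  rw [Finset.sum_mul_sum, ← Fintype.sum_prod_type', ← Fintype.sum_prod_type']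
  simp only [ite_mul, zero_mul]
  rw [← Finset.sum_filter, ← Finset.sum_filter]
  symm
  refine Finset.sum_bij (fun x _ => (fun h => x.2 (Sum.inl (Quotient.mk _ (otherHalf E h))),
    fun v => x.2 (Sum.inr v))) ?_ ?_ ?_ ?_
  · rintro ⟨l, b⟩ hb
    simp only [Finset.mem_filter, Finset.mem_univ, true_and] at hb ⊢
    have hface : ∀ h : E × Bool, (Quotient.mk (Equiv.Perm.SameCycle.setoid M.facePerm)
        (otherHalf E (M.rot h))) = Quotient.mk _ h := fun h =>
      Quotient.sound ⟨1, by rw [zpow_one, facePerm_otherHalf_rot]⟩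
    refine fun e => ⟨?_, ?_, ?_⟩ <;> dsimp only
    · rw [hface]; rfl
    · rw [hface]; rfl
    · rw [hb, hb, hface]
      exact congrArg l (M.vertComp_otherHalf (e, true))
  · rintro ⟨l, b⟩ hb ⟨l', b'⟩ hb' heq
    simp only [Finset.mem_filter, Finset.mem_univ, true_and] at hb hb'
    have hbb : b = b' := by
      funext f
      rcases f with q | v
      · induction q using Quotient.inductionOn with
        | _ h =>
          have := congrFun (congrArg Prod.fst heq) (otherHalf E h)
          simpa only [otherHalf_otherHalf] using this
      · exact congrFun (congrArg Prod.snd heq) v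
    subst hbb
    have hll : l = l' := by
      funext C
      obtain ⟨f, rfl⟩ := M.faceComp_surjective C
      rw [← hb, ← hb']
    rw [hll]
  · rintro ⟨a, a'⟩ ha
    simp only [Finset.mem_filter, Finset.mem_univ, true_and] at ha
    -- The first two clauses of compatibility are one relation, read at the two halves of an edge.
    have ha1 : ∀ h, a (M.rot (otherHalf E h)) = a h := by
      rintro ⟨e, _ | _⟩
      · exact (ha e).2.1
      · exact (ha e).1.symm
    have ha2 : ∀ h, (a (otherHalf E h)).1 = (a h).1 := by
      have key : ∀ e, (a (e, true)).1 = (a (e, false)).1 := fun e => by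
        rw [(ha e).2.2, (ha e).2.1]
      rintro ⟨e, _ | _⟩
      · exact key e
      · exact (key e).symm
    have ha3 : ∀ h, (a (M.rot h)).1 = (a h).1 := by
      intro h
      rw [← ha2 h, ← ha1 (otherHalf E h), otherHalf_otherHalf]
    obtain ⟨l, hl, hl'⟩ := M.exists_component_label (fun h => (a h).1) ha3 ha2
      (fun v => (a' v).1)
    have hface : ∀ h, a (otherHalf E (M.facePerm h)) = a (otherHalf E h) := by
      intro h
      rw [← ha1, otherHalf_otherHalf, facePerm_apply, ← Equiv.Perm.mul_apply, mul_inv_cancel,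
        Equiv.Perm.one_apply]
    refine ⟨(l, Sum.elim (Quotient.lift (fun h => a (otherHalf E h)) fun h h' hh =>
      eq_of_sameCycle (h := fun h => a (otherHalf E h)) hface hh) a'), ?_, ?_⟩
    · simp only [Finset.mem_filter, Finset.mem_univ, true_and]
      rintro (q | v)
      · induction q using Quotient.inductionOn with
        | _ h => exact (ha2 h).trans (hl h).symm
      · exact (hl' v).symm
    · refine Prod.ext (funext fun h => ?_) rfl
      change a (otherHalf E (otherHalf E h)) = a h
      rw [otherHalf_otherHalf]
  · rintro ⟨l, b⟩ hb
    simp only [Finset.mem_filter, Finset.mem_univ, true_and] at hb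
    dsimp only
    rw [← M.vertexEquiv.prod_comp, Fintype.prod_sum_type]
    simp only [hb, vertexEquiv_inl, vertexEquiv_inr]
    have h1 : ∀ h, l (M.faceComp (Sum.inl (Quotient.mk _ (otherHalf E h)))) =
        l (M.vertComp (M.vert h)) := fun h => congrArg l (M.vertComp_otherHalf h)
    simp only [h1]
    have h2 : ∀ v, M.faceComp (Sum.inr v) = M.vertComp v.1 := fun v => rfl
    simp only [h2, edgeComp]
    ring

open Classical in
-- With the irreducibles `l` fixed, each face chooses its index freely among the `d` of its block.
-- Collecting vertex, edge and face factors by component gives the Euler characteristic as exponent.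
theorem sum_label_eq_prod_component [Fintype E] [Fintype M.Face] [Fintype V]
    (hd : ∀ i, d i ≠ 0) :
    (∑ l : M.Component → ι, ∑ b : M.Face → Σ i, Fin (d i),
      if ∀ f, (b f).1 = l (M.faceComp f) then
        (∏ v, (d (l (M.vertComp v)) : ℂ)) * ∏ e, (d (l (M.edgeComp e)) : ℂ)⁻¹ else 0) =
    ∏ C : M.Component, ∑ i, (d i : ℂ) ^ M.eulerChar C := by
  rw [Finset.prod_univ_sum, Fintype.piFinset_univ]
  refine Finset.sum_congr rfl fun l _ => ?_
  have h1 : ∀ i : ι, ∑ p : Σ i, Fin (d i), (if p.1 = i then (1 : ℂ) else 0) = d i := by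
    intro i
    rw [Fintype.sum_sigma, Finset.sum_eq_single i]
    · simp
    · intro j _ hj
      simp [hj]
    · simp
  have h2 : ∑ b : M.Face → Σ i, Fin (d i),
      (if ∀ f, (b f).1 = l (M.faceComp f) then (1 : ℂ) else 0) =
      ∏ f, (d (l (M.faceComp f)) : ℂ) := by
    simp only [← h1]
    rw [Finset.prod_univ_sum, Fintype.piFinset_univ]
    refine Finset.sum_congr rfl fun b _ => ?_
    rw [Finset.prod_ite_zero, Finset.prod_const_one]
    simp
  calc _ = ((∏ v, (d (l (M.vertComp v)) : ℂ)) * ∏ e, (d (l (M.edgeComp e)) : ℂ)⁻¹) *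
        ∑ b : M.Face → Σ i, Fin (d i),
          (if ∀ f, (b f).1 = l (M.faceComp f) then (1 : ℂ) else 0) := by
        rw [Finset.mul_sum]
        simp only [mul_ite, mul_one, mul_zero]
    _ = _ := by
      rw [h2, prod_comp_eq_prod_pow_card M.vertComp fun C => (d (l C) : ℂ),
        prod_comp_eq_prod_pow_card M.edgeComp fun C => (d (l C) : ℂ)⁻¹,
        prod_comp_eq_prod_pow_card M.faceComp fun C => (d (l C) : ℂ),
        ← Finset.prod_mul_distrib, ← Finset.prod_mul_distrib]
      refine Finset.prod_congr rfl fun C _ => ?_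
      have h0 : (d (l C) : ℂ) ≠ 0 := Nat.cast_ne_zero.2 (hd _)
      rw [eulerChar, zpow_add₀ h0, zpow_sub₀ h0, zpow_natCast, zpow_natCast, zpow_natCast,
        inv_pow, div_eq_mul_inv]

open Classical in
theorem card_localFlow_eq_prod_component [Finite E] [Finite V] (hd : ∀ i, d i ≠ 0)
    (htr : ∀ g, ∑ p, (d p.1 : ℂ) * R g p p = if g = 1 then (Nat.card G : ℂ) else 0)
    (horth : ∀ p q r s, ∑ g, R g p q * R g⁻¹ r s =
        if p = s ∧ q = r ∧ p.1 = q.1 then (Nat.card G : ℂ) / d p.1 else 0) :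
    (Nat.card {x : E → G // M.IsLocalFlow x} : ℂ) =
      (Nat.card G : ℂ) ^ ((Nat.card E : ℤ) - Nat.card V) *
        ∏ C : M.Component, ∑ i, (d i : ℂ) ^ M.eulerChar C := by
  have := Fintype.ofFinite E
  have := Fintype.ofFinite V
  have := Fintype.ofFinite M.Face
  have hG : (Nat.card G : ℂ) ≠ 0 := Nat.cast_ne_zero.2 Nat.card_pos.ne'
  -- Each isolated vertex contributes the sum of the squares of the dimensions, which is `|G|` by
  -- the trace formula at `1`. This cancels against its `1/|G|` in `|G| ^ (|E| - |V|)`.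
  have hiso : ∑ a' : {v : V // v ∉ Set.range M.vert} → Σ i, Fin (d i), ∏ v, (d (a' v).1 : ℂ) =
      (Nat.card G : ℂ) ^ Nat.card {v : V // v ∉ Set.range M.vert} := by
    have h1 : ∑ p : Σ i, Fin (d i), (d p.1 : ℂ) = Nat.card G := by
      simpa using htr 1
    rw [← h1, Nat.card_eq_fintype_card, ← Finset.card_univ, ← Finset.prod_const,
      Finset.prod_univ_sum, Fintype.piFinset_univ]
  have hV : Nat.card V = Nat.card (Quotient (Equiv.Perm.SameCycle.setoid M.rot)) +
      Nat.card {v : V // v ∉ Set.range M.vert} := by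
    rw [← Nat.card_congr M.vertexEquiv, Nat.card_sum]
  rw [← M.sum_label_eq_prod_component hd, ← M.sum_compatible_eq_sum_label, hiso,
    M.card_localFlow_eq_sum_compatible htr horth, hV, zpow_sub₀ hG, zpow_natCast, zpow_natCast,
    pow_add, inv_pow]
  field_simp

end Count

/-- The number of local flows of a map. -/
theorem card_localFlow {V E : Type*} (M : RotMap V E) [Finite V] [Finite E] (G : Type*) [Group G]
    [Finite G] :
    (Nat.card {x : E → G // M.IsLocalFlow x} : ℚ) =
      (Nat.card G : ℚ) ^ M.nullity *
        ∏ C : M.Component, (1 / (Nat.card G : ℚ) *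
          ∑ l : IrrClass G, (l.dim : ℚ) ^ M.eulerChar C) := by
  classical
  have := Fintype.ofFinite G
  obtain ⟨n, d, e, R, hd, he, htr, horth⟩ := exists_block_representation G
  have hG : (Nat.card G : ℚ) ≠ 0 := Nat.cast_ne_zero.2 Nat.card_pos.ne'
  have h1 : ∀ z : ℤ, ∑ l : IrrClass G, (l.dim : ℚ) ^ z = ∑ i, (d i : ℚ) ^ z := by
    intro z
    rw [← e.sum_comp]
    simp only [he]
  have h2 : (Nat.card {x : E → G // M.IsLocalFlow x} : ℚ) =
      (Nat.card G : ℚ) ^ ((Nat.card E : ℤ) - Nat.card V) *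
        ∏ C : M.Component, ∑ i, (d i : ℚ) ^ M.eulerChar C := by
    have h3 := M.card_localFlow_eq_prod_component hd htr horth
    -- The matrix entries are complex, but both sides of the final count are rational.
    apply Rat.cast_injective (α := ℂ)
    push_cast
    exact h3
  simp only [h1]
  rw [h2, Finset.prod_mul_distrib, Finset.prod_const, Finset.card_univ,
    ← Nat.card_eq_fintype_card, nullity, zpow_add₀ hG, zpow_natCast, one_div, inv_pow]
  field_simp

/-! ### Inclusion–exclusion over deleted edges -/

section InclusionExclusion

variable {V E : Type*} (M : RotMap V E) {G : Type*} [Group G]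

theorem isLocalFlow_delete_iff [Finite E] (B : Finset E) {x : E → G} (hx : ∀ e ∈ B, x e = 1) :
    (M.delete B).IsLocalFlow (fun e => x e.1) ↔ M.IsLocalFlow x := by
  have hy : ∀ h : E × Bool, ¬ h.1 ∉ B → signedValue x h = 1 := by
    intro h hB
    simp [signedValue, hx h.1 (not_not.1 hB)]
  have key : ∀ h : {h : E × Bool // h.1 ∉ B},
      cycleProd (M.delete B).rot (signedValue fun e => x e.1) (keptHalfEdges B h) =
        cycleProd M.rot (signedValue x) h.1 := by
    intro h
    rw [← cycleProd_firstReturn M.rot (fun h : E × Bool => h.1 ∉ B) hy h]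
    exact cycleProd_permCongr _ (keptHalfEdges B) _ h
  constructor
  · intro hflow h
    by_cases hp : ∃ h', h'.1 ∉ B ∧ M.rot.SameCycle h h'
    · obtain ⟨h', hB, hs⟩ := hp
      rw [cycleProd_eq_one_iff_of_sameCycle _ _ hs]
      exact (key ⟨h', hB⟩).symm.trans (hflow _)
    -- The whole rotation cycle is deleted: it has no counterpart in `M.delete B`, and its product
    -- consists of ones.
    · push Not at hp
      refine List.prod_eq_one fun g hg => ?_
      obtain ⟨k, -, rfl⟩ := List.mem_map.1 hg
      refine hy _ fun hB => hp _ hB ?_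
      exact Equiv.Perm.sameCycle_pow_right.2 (Equiv.Perm.SameCycle.refl _ _)
  · intro hflow h
    rw [← (keptHalfEdges B).apply_symm_apply h, key]
    exact hflow _

theorem card_localFlow_trivial_on [Finite E] (B : Finset E) :
    Nat.card {x : E → G // M.IsLocalFlow x ∧ ∀ e ∈ B, x e = 1} =
      Nat.card {x : {e // e ∉ B} → G // (M.delete B).IsLocalFlow x} := by
  classical
  refine Nat.card_congr
    { toFun := fun x => ⟨fun e => x.1 e.1, (M.isLocalFlow_delete_iff B x.2.2).2 x.2.1⟩
      invFun := fun y => ⟨fun e => if h : e ∉ B then y.1 ⟨e, h⟩ else 1, ?_⟩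
      left_inv := ?_
      right_inv := ?_ }
  · have h1 : ∀ e ∈ B, (if h : e ∉ B then y.1 ⟨e, h⟩ else 1) = 1 := fun e he => by simp [he]
    refine ⟨(M.isLocalFlow_delete_iff B h1).1 ?_, h1⟩
    convert y.2 using 2 with e
    exact dif_pos e.2
  · rintro ⟨x, hx, hx1⟩
    apply Subtype.ext
    funext e
    by_cases he : e ∈ B
    · simp [he, hx1 e he]
    · simp [he]
  · rintro ⟨y, hy⟩
    apply Subtype.ext
    funext e
    exact dif_pos e.2

theorem numFlows_eq_sum_delete [Fintype E] [Finite G] :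
    (M.numFlows G : ℚ) = ∑ B : Finset E, (-1 : ℚ) ^ B.card *
      Nat.card {x : {e // e ∉ B} → G // (M.delete B).IsLocalFlow x} := by
  classical
  have := Fintype.ofFinite G
  have h1 : ∀ x : E → G, (if ∀ e, x e ≠ 1 then (1 : ℚ) else 0) =
      ∑ B : Finset E, (-1) ^ B.card * if ∀ e ∈ B, x e = 1 then (1 : ℚ) else 0 := by
    intro x
    -- Expand the product over the edges of one minus the indicator of `x e = 1`.
    calc (if ∀ e, x e ≠ 1 then (1 : ℚ) else 0) =
          ∏ e, ((-1) * (if x e = 1 then (1 : ℚ) else 0) + 1) := by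
          rw [Finset.prod_congr rfl (g := fun e => if x e ≠ 1 then (1 : ℚ) else 0)
            fun e _ => by by_cases h : x e = 1 <;> simp [h]]
          rw [Finset.prod_ite_zero, Finset.prod_const_one]
          simp only [Finset.mem_univ, forall_true_left]
      _ = _ := by
          rw [Finset.prod_add, Finset.powerset_univ]
          refine Finset.sum_congr rfl fun B _ => ?_
          rw [Finset.prod_const_one, mul_one, Finset.prod_mul_distrib, Finset.prod_const,
            Finset.prod_ite_zero, Finset.prod_const_one]
          congr
  have h2 : ∀ p : (E → G) → Prop, (Nat.card {x : E → G // M.IsLocalFlow x ∧ p x} : ℚ) =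
      ∑ x : E → G, if M.IsLocalFlow x then (if p x then (1 : ℚ) else 0) else 0 := by
    intro p
    rw [Nat.card_eq_fintype_card, Fintype.card_subtype, ← Finset.sum_boole]
    simp only [ite_and]
  rw [numFlows, h2]
  simp only [← card_localFlow_trivial_on, h2, Finset.mul_sum]
  rw [Finset.sum_comm]
  refine Finset.sum_congr rfl fun x _ => ?_
  by_cases hx : M.IsLocalFlow x
  · simp only [if_pos hx]
    convert h1 x
  · simp [hx]

end InclusionExclusion

/-! ### Surface duality -/

section Duality

variable {V E : Type*} (M : RotMap V E)

/-- Face tracing in the dual is the rotation of `M` conjugated by `otherHalf`. -/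
theorem dual_facePerm_sameCycle_iff (h h' : E × Bool) :
    M.dual.facePerm.SameCycle h h' ↔ M.rot.SameCycle (otherHalf E h) (otherHalf E h') := by
  have ho : (otherHalf E)⁻¹ = otherHalf E := by
    rw [inv_eq_iff_mul_eq_one]
    ext1 x
    exact otherHalf_otherHalf x
  have hf : M.dual.facePerm = otherHalf E * M.rot * (otherHalf E)⁻¹ := by
    change (M.rot⁻¹ * otherHalf E)⁻¹ * otherHalf E = _
    rw [mul_inv_rev, inv_inv, ho]
  rw [hf, Equiv.Perm.sameCycle_conj, ho]

/-- The components of the dual correspond to those of the map. -/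
theorem exists_dual_component_equiv [Finite E] :
    ∃ l : M.dual.Component ≃ M.Component, ∀ f, l (M.dual.vertComp f) = M.faceComp f := by
  obtain ⟨l, hl⟩ := M.dual.exists_component_lift M.faceComp fun e =>
    M.vertComp_otherHalf (e, false)
  obtain ⟨l', hl', hl''⟩ := M.exists_component_label
    (fun h => M.dual.vertComp (Sum.inl (Quotient.mk _ h)))
    (fun h => by
      have h1 : (Quotient.mk (Equiv.Perm.SameCycle.setoid M.facePerm)
          (otherHalf E (M.rot h))) = Quotient.mk _ h :=
        Quotient.sound ⟨1, by rw [zpow_one, facePerm_otherHalf_rot]⟩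
      rw [← h1]
      exact (M.dual.vertComp_otherHalf (M.rot h)).symm)
    (fun h => M.dual.vertComp_otherHalf h)
    (fun v => M.dual.vertComp (Sum.inr v))
  have hface : ∀ f, l' (M.faceComp f) = M.dual.vertComp f := by
    rintro (q | v)
    · induction q using Quotient.inductionOn with
      | _ h => exact hl' h
    · exact hl'' v
  refine ⟨⟨l, l', fun C => ?_, fun C => ?_⟩, hl⟩
  · induction C using SimpleGraph.ConnectedComponent.ind with
    | _ f => exact (congrArg l' (hl f)).trans (hface f)
  · obtain ⟨f, rfl⟩ := M.faceComp_surjective C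
    rw [hface, hl]

/-- The faces of the dual correspond to the vertices of the map. -/
theorem exists_dual_face_equiv [Finite E] (l : M.dual.Component → M.Component)
    (hl : ∀ f, l (M.dual.vertComp f) = M.faceComp f) :
    ∃ r : M.dual.Face ≃ V, ∀ f, l (M.dual.faceComp f) = M.vertComp (r f) := by
  let r : M.dual.Face → V := Sum.elim
    (Quotient.lift (fun h => M.vert (otherHalf E h)) fun h h' hh =>
      (M.vert_eq_iff _ _).2 ((M.dual_facePerm_sameCycle_iff h h').1 hh))
    (fun f => Sum.elim (fun q => M.vert q.out) Subtype.val f.1)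
  have hiso : ∀ f : {f : M.Face // f ∉ Set.range M.dual.vert}, ∃ v, f.1 = Sum.inr v := by
    rintro ⟨q | v, hf⟩
    · induction q using Quotient.inductionOn with
      | _ h => exact absurd ⟨h, rfl⟩ hf
    · exact ⟨v, rfl⟩
  have hr : Function.Bijective r := by
    constructor
    · rintro (q | ⟨f, hf⟩) (q' | ⟨f', hf'⟩) heq
      · induction q using Quotient.inductionOn with
        | _ h =>
        induction q' using Quotient.inductionOn with
        | _ h' =>
        exact congrArg Sum.inl (Quotient.sound
          ((M.dual_facePerm_sameCycle_iff h h').2 ((M.vert_eq_iff _ _).1 heq)))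
      · obtain ⟨v, rfl⟩ : ∃ v, f' = Sum.inr v := hiso ⟨f', hf'⟩
        induction q using Quotient.inductionOn with
        | _ h => exact absurd ⟨_, heq⟩ v.2
      · obtain ⟨v, rfl⟩ : ∃ v, f = Sum.inr v := hiso ⟨f, hf⟩
        induction q' using Quotient.inductionOn with
        | _ h => exact absurd ⟨_, heq.symm⟩ v.2
      · obtain ⟨v, rfl⟩ : ∃ v, f = Sum.inr v := hiso ⟨f, hf⟩
        obtain ⟨v', rfl⟩ : ∃ v, f' = Sum.inr v := hiso ⟨f', hf'⟩
        obtain rfl : v = v' := Subtype.ext heq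
        rfl
    · intro v
      by_cases hv : v ∈ Set.range M.vert
      · obtain ⟨h, rfl⟩ := hv
        exact ⟨Sum.inl (Quotient.mk _ (otherHalf E h)),
          congrArg M.vert (otherHalf_otherHalf h)⟩
      · refine ⟨Sum.inr ⟨Sum.inr ⟨v, hv⟩, ?_⟩, rfl⟩
        rintro ⟨h, hh⟩
        exact Sum.inl_ne_inr hh
  refine ⟨Equiv.ofBijective r hr, ?_⟩
  rintro (q | ⟨f, hf⟩)
  · induction q using Quotient.inductionOn with
    | _ h => exact (hl _).trans (M.vertComp_otherHalf h).symm
  · obtain ⟨v, rfl⟩ : ∃ v, f = Sum.inr v := hiso ⟨f, hf⟩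
    exact hl _

theorem dualNullity_dual [Finite E] : M.dual.dualNullity = M.nullity := by
  obtain ⟨l, hl⟩ := M.exists_dual_component_equiv
  obtain ⟨r, -⟩ := M.exists_dual_face_equiv l hl
  rw [dualNullity, nullity, Nat.card_congr r, Nat.card_congr l]

theorem eulerChar_dual [Finite E] (l : M.dual.Component ≃ M.Component)
    (hl : ∀ f, l (M.dual.vertComp f) = M.faceComp f) (C : M.dual.Component) :
    M.dual.eulerChar C = M.eulerChar (l C) := by
  obtain ⟨r, hr⟩ := M.exists_dual_face_equiv l hl
  have hV : Nat.card {f // M.dual.vertComp f = C} = Nat.card {f // M.faceComp f = l C} :=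
    Nat.card_congr (Equiv.subtypeEquivRight fun f => by rw [← hl, l.injective.eq_iff])
  have hE : Nat.card {e // M.dual.edgeComp e = C} = Nat.card {e // M.edgeComp e = l C} :=
    Nat.card_congr (Equiv.subtypeEquivRight fun e => by
      rw [← l.injective.eq_iff]
      exact iff_of_eq (congrArg (· = l C) (hl _)))
  have hF : Nat.card {f // M.dual.faceComp f = C} = Nat.card {v // M.vertComp v = l C} :=
    Nat.card_congr (r.subtypeEquiv fun f => by rw [← hr, l.injective.eq_iff])
  rw [eulerChar, eulerChar, hV, hE, hF]
  ring

end Duality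

end RotMap

end SurfaceMap

theorem mainTheorem3 {V E : Type*} [Finite V] [Fintype E] [DecidableEq E]
    (M : SurfaceMap.RotMap V E) (G : Type*) [Group G] [Finite G] :
    (M.numFlows G : ℚ) =
        ∑ A : Finset E, (-1 : ℚ) ^ (Aᶜ).card * (Nat.card G : ℚ) ^ (M.delete Aᶜ).nullity *
          ∏ C : (M.delete Aᶜ).Component,
            (1 / (Nat.card G : ℚ) *
              ∑ l : SurfaceMap.IrrClass G, (l.dim : ℚ) ^ (M.delete Aᶜ).eulerChar C) ∧
      (M.numTensions G : ℚ) =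
        ∑ A : Finset E, (-1 : ℚ) ^ A.card * (Nat.card G : ℚ) ^ (M.contract A).dualNullity *
          ∏ C : (M.contract A).Component,
            (1 / (Nat.card G : ℚ) *
              ∑ l : SurfaceMap.IrrClass G, (l.dim : ℚ) ^ (M.contract A).eulerChar C) := by
  constructor
  -- In the statement `A` is the set of kept edges, so the sum over deleted sets is reindexed by
  -- complements.
  · rw [M.numFlows_eq_sum_delete, ← Equiv.sum_comp (compl_involutive (α := Finset E)).toPerm]
    refine Finset.sum_congr rfl fun A _ => ?_
    rw [mul_assoc, ← SurfaceMap.RotMap.card_localFlow]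
    rfl
  -- The rotation of the dual is by definition the face permutation of `M`.
  · have hdual : M.numTensions G = M.dual.numFlows G := rfl
    rw [hdual, M.dual.numFlows_eq_sum_delete]
    refine Finset.sum_congr rfl fun A _ => ?_
    -- `M.contract A` is the dual of `M.dual.delete A`, so its dual nullity and Euler
    -- characteristics are the nullity and Euler characteristics of that deletion.
    obtain ⟨l, hl⟩ := (M.dual.delete A).exists_dual_component_equiv
    rw [SurfaceMap.RotMap.card_localFlow, mul_assoc, SurfaceMap.RotMap.contract,
      SurfaceMap.RotMap.dualNullity_dual, ← l.prod_comp]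
    simp only [SurfaceMap.RotMap.eulerChar_dual _ l hl]
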